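/- **Setting.** Let $\mathcal Y=[k]$ with $k\ge 2$, let $\Delta\mathcal Y\subset\mathbb R^k$ be the probability simplex and $\mathrm{ri}(\Delta\mathcal Y)$ its relative interior (all coordinates positive). In each round $t=1,\dots,T$ ($T\ge 1$), an adaptive randomized adversary picks a context $x_t$ as a function of the past transcript $\pi_{t-1}$; a learner draws a prediction $p_t\in\Delta\mathcal Y$ from a distribution depending on $(\pi_{t-1},x_t)$; and the adversary draws a label from a distribution depending on $(\pi_{t-1},x_t)$, independently of $p_t$ given $(\pi_{t-1},x_t)$. Write $y_t$ for the standard basis vector of the label and $\pi_T=(x_t,p_t,y_t)_{t\le T}$. An event is a measurable map $E(\pi_{t-1},x_t,p_t)\in[0,1]$. A competing predictor $q$ makes in round $t$ the prediction $q_t(p_t)\in\Delta\mathcal Y$, where the measurable mapping $q_t:\Delta\mathcal Y\to\Delta\mathcal Y$ is determined by $(\pi_{t-1},x_t)$. Let $\mathcal Q$ be a finite nonempty family of competing predictors. **Bregman losses.** For $f:[0,1]\to\mathbb R$ strictly convex and differentiable on $(0,1)$, put $d_f(p_1,p_2)=\sum_{i}\{f(p_{1,i})-f(p_{2,i})-f'(p_{2,i})(p_{1,i}-p_{2,i})\}$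 for $p_1\in\Delta\mathcal Y$, $p_2\in\mathrm{ri}(\Delta\mathcal Y)$. For a scoring rule $\phi:\Delta\mathcal Y\times[k]\to[0,\infty]$, the expected score $\ell(p_1,p_2)=\sum_i p_{2,i}\,\phi(p_1,i)$ is a Bregman score with divergence $d_\ell$ if $d_\ell=d_f$ for some such $f$ and, for all $p_1\in\mathrm{ri}(\Delta\mathcal Y)$ and $p_2\in\Delta\mathcal Y$, both $\ell(p_1,p_2)$ and $\ell(p_2,p_2)$ are finite and $\ell(p_1,p_2)-\ell(p_2,p_2)=d_\ell(p_2,p_1)$. The losses are $L_\ell(p,\pi_T)=\sum_{t\le T}\ell(p_t,y_t)$ and $L_\ell(q,\pi_T)=\sum_{t\le T}\ell(q_t(p_t),y_t)$. For $L>0$, $\mathcal L_L$ is the family of Bregman losses with $|d_\ell(p_1,p_2)-d_\ell(p_1,p_2')|\le L\|p_2-p_2'\|_1$ for all $p_1\in\Delta\mathcal Y$ and $p_2,p_2'\in\mathrm{ri}(\Delta\mathcal Y)$. **Level sets.** Let $\delta=\Theta(T^{-1/4})$. For every $i\in[k]$ and $q\in\mathcal Q$ let $\Omega^{p,i}$ and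 $\Omega^{q,i}$ be partitions of $[0,1]$ into $O(1/\delta)$ consecutive subintervals of length at most $\delta$. Let $\mathcal E$ be a family of $O(k|\mathcal Q|/\delta^2)$ events which includes all $$E^{q,i}_{a,b}=\mathbf 1\big[p_{t,i}\in\Omega^{p,i}_a\ \wedge\ q_{t,i}(p_t)\in\Omega^{q,i}_b\big].$$ Predictions are called *unbiased on $\mathcal E$ with constant $c$* if for all $E\in\mathcal E$ and $i\in[k]$, with $E_t=E(\pi_{t-1},x_t,p_t)$ and $\Lambda=\ln(2k|\mathcal E|T)$, $$\mathbb E\Big|\sum_{t\le T}E_t\,(p_{t,i}-y_{t,i})\Big|\le c\Big(\Lambda+\sqrt{\Lambda\sum_{t\le T}\mathbb E[E_t^2]}\Big).$$ **Theorem (Beating competing predictors under all $L$-Lipschitz Bregman losses).** (1) Suppose that, against a given adversary, the learner's predictions are unbiased on $\mathcal E$ with constant $c$, and that almost surely all $p_{t,i}$ and all $q_{t,i}(p_t)$ ($t\le T$, $i\in[k]$, $q\in\mathcal Q$) lie in $(0,1)$. Then for every $L>0$, simultaneously for all $L_\ell\in\mathcal L_L$, $$\mathbb E[L_\ell(p,\pi_T)]\le\min_{q\in\mathcal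 Q}\mathbb E[L_\ell(q,\pi_T)]+O\big(L\,k\,\sqrt{\ln(k|\mathcal Q|T)}\;T^{3/4}\big),$$ where the constant in $O(\cdot)$ depends only on $c$ and on the implied constants in the choice of $\delta$, of the numbers of subintervals and of $|\mathcal E|$. (2) There is a universal constant $c$ such that for all such data $(\mathcal Q,\delta,\Omega,\mathcal E)$ there is a learner which, against every adversary, almost surely predicts with all coordinates in $(0,1)$, is unbiased on $\mathcal E$ with constant $c$, and, whenever almost surely all $q_{t,i}(p_t)$ lie in $(0,1)$, satisfies for every $L>0$ and all $L_\ell\in\mathcal L_L$ $$\mathbb E[L_\ell(p,\pi_T)]\le\mathbb E\Big[\min_{q\in\mathcal Q}L_\ell(q,\pi_T)\Big]+O\big(L\,k\,\sqrt{\ln(k|\mathcal Q|T)}\;T^{3/4}\big),$$ where the constant in $O(\cdot)$ depends only on the implied constants in the choice of $\delta$, of the numbers of subintervals and of $|\mathcal E|$. -/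

import Mathlib

open MeasureTheory ProbabilityTheory
open scoped ENNReal

noncomputable section

namespace Omnipred

/-! ### The sequential prediction protocol -/

/-- The probability simplex `Δ𝒴` over the label set `𝒴 = Fin k`. -/
abbrev Simplex (k : ℕ) : Type := stdSimplex ℝ (Fin k)

/-- The `j`-th standard basis vector, as a point of the simplex. -/
def oneHot {k : ℕ} (j : Fin k) : Simplex k :=
  ⟨Pi.single j 1, single_mem_stdSimplex ℝ j⟩

/-- The relative interior of the simplex: all coordinates are positive. -/
def riSimplex (k : ℕ) : Set (Simplex k) := {p | ∀ i, 0 < p.1 i}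

/-- A realized triple (context, prediction, label). The outcome vector of the round is the
basis vector `oneHot` of the label. -/
abbrev Round (X : Type*) (k : ℕ) : Type _ := X × Simplex k × Fin k

/-- Transcripts of length `t`. -/
abbrev Transcript (X : Type*) (k t : ℕ) : Type _ := Fin t → Round X k

/-- The part of a transcript that precedes round `t`. -/
def past {X : Type*} {k T : ℕ} (π : Transcript X k T) (t : Fin T) : Transcript X k t :=
  fun s => π (Fin.castLE t.is_lt.le s)

/-- A learner: in round `t` it maps the past transcript and the current context to a probability
distribution over predictions. -/
structure Learner (X : Type*) [MeasurableSpace X] (k : ℕ) where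
  pred : ∀ t : ℕ, Kernel (Transcript X k t × X) (Simplex k)
  markov : ∀ t, IsMarkovKernel (pred t)

/-- An adaptive randomized adversary: in round `t` it draws a context given the past transcript, and
then a label given the past transcript and the context, independently of the learner's prediction
in that round. -/
structure Adversary (X : Type*) [MeasurableSpace X] (k : ℕ) where
  context : ∀ t : ℕ, Kernel (Transcript X k t) X
  label : ∀ t : ℕ, Kernel (Transcript X k t × X) (Fin k)
  context_markov : ∀ t, IsMarkovKernel (context t)
  label_markov : ∀ t, IsMarkovKernel (label t)

section Law

variable {X : Type*} [MeasurableSpace X] {k : ℕ}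

/-- The conditional law of round `t` given the past: first the context, then, independently given
the context, the learner's prediction and the label. -/
def roundKernel (A : Learner X k) (B : Adversary X k) (t : ℕ) :
    Kernel (Transcript X k t) (Round X k) :=
  (B.context t).compProd ((A.pred t).prod (B.label t))

/-- The law of the transcript `π_T` of the first `T` rounds. -/
def transcriptLaw (A : Learner X k) (B : Adversary X k) : ∀ T : ℕ, Measure (Transcript X k T)
  | 0 => Measure.dirac Fin.elim0
  | T + 1 => ((transcriptLaw A B T).compProd (roundKernel A B T)).map
      (fun z => Fin.snoc (α := fun _ => Round X k) z.1 z.2)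

instance (A : Learner X k) (B : Adversary X k) (t : ℕ) : IsMarkovKernel (roundKernel A B t) := by
  have h1 := A.markov t
  have h2 := B.context_markov t
  have h3 := B.label_markov t
  unfold roundKernel
  infer_instance

theorem measurable_snoc (T : ℕ) : Measurable (fun z : Transcript X k T × Round X k =>
    (Fin.snoc (α := fun _ => Round X k) z.1 z.2 : Transcript X k (T + 1))) := by
  refine measurable_pi_lambda _ (fun i => ?_)
  refine Fin.lastCases ?_ (fun j => ?_) i
  · simpa using measurable_snd
  · simp only [Fin.snoc_castSucc]
    exact (measurable_pi_apply j).comp measurable_fst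

instance (A : Learner X k) (B : Adversary X k) (T : ℕ) :
    IsProbabilityMeasure (transcriptLaw A B T) := by
  induction T with
  | zero => unfold transcriptLaw; infer_instance
  | succ T ih =>
    unfold transcriptLaw
    exact Measure.isProbabilityMeasure_map (measurable_snoc T).aemeasurable

end Law

/-! ### Events and event-conditional unbiasedness -/

/-- `[0,1]`-valued functions of the past transcript, the context and the prediction are events,
see `IsEvent`. -/
abbrev Event (X : Type*) (k : ℕ) : Type _ := ∀ t : ℕ, Transcript X k t → X → Simplex k → ℝ

/-- Events are measurable with values in `[0,1]`. -/
def IsEvent {X : Type*} [MeasurableSpace X] {k : ℕ} (E : Event X k) : Prop :=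
  (∀ t h x p, E t h x p ∈ Set.Icc (0 : ℝ) 1) ∧
  ∀ t, Measurable (fun z : Transcript X k t × X × Simplex k => E t z.1 z.2.1 z.2.2)

/-- The value `E(π^{<t}, x_t, p_t)` of the event `E` in round `t` of the transcript. -/
def Event.at {X : Type*} {k T : ℕ} (E : Event X k) (π : Transcript X k T) (t : Fin T) : ℝ :=
  E t (past π t) (π t).1 (π t).2.1

/-- The bias `∑_t E(x_t, p_t) (p_{t,i} - y_{t,i})` in coordinate `i` conditional on `E`. -/
def bias {X : Type*} {k T : ℕ} (E : Event X k) (i : Fin k) (π : Transcript X k T) : ℝ :=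
  ∑ t, E.at π t * ((π t).2.1.1 i - (oneHot (π t).2.2).1 i)

/-- Unbiasedness (in expectation) of the predictions over `T` rounds conditional on the finite
family `𝓔`, with constant `c`: for every event `E ∈ 𝓔` and every coordinate `i`,
`𝔼 |∑_t E(x_t,p_t)(p_{t,i} - y_{t,i})| ≤ c (ln (2k|𝓔|T) + √(ln (2k|𝓔|T) ∑_t 𝔼 E(x_t,p_t)²))`. -/
def UnbiasedOn {X : Type*} [MeasurableSpace X] {k : ℕ} (c : ℝ) (𝓔 : Finset (Event X k)) (T : ℕ)
    (A : Learner X k) (B : Adversary X k) : Prop :=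
  ∀ E ∈ 𝓔, ∀ i : Fin k,
    ∫ π, |bias E i π| ∂(transcriptLaw A B T) ≤
      c * (Real.log (2 * k * 𝓔.card * T) +
        √(Real.log (2 * k * 𝓔.card * T) *
          ∑ t : Fin T, ∫ π, (E.at π t) ^ 2 ∂(transcriptLaw A B T)))

/-! ### Competing predictors and level sets -/

/-- A competing predictor: in round `t` its prediction mapping `q_t : Δ𝒴 → Δ𝒴` is known before the
learner predicts, that is, it is determined by the past transcript and the context. -/
structure Competitor (X : Type*) [MeasurableSpace X] (k : ℕ) where
  map : ∀ t : ℕ, Transcript X k t → X → Simplex k → Simplex k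
  measurable_map : ∀ t,
    Measurable (fun z : Transcript X k t × X × Simplex k => map t z.1 z.2.1 z.2.2)

/-- The prediction `q_t(p_t)` of a competing predictor in round `t`. -/
def Competitor.play {X : Type*} [MeasurableSpace X] {k T : ℕ} (q : Competitor X k)
    (π : Transcript X k T) (t : Fin T) : Simplex k :=
  q.map t (past π t) (π t).1 (π t).2.1

/-- A `δ`-partition: a partition of `[0,1]` into finitely many subintervals, in order, each of
length at most `δ`. -/
structure DeltaPartition (δ : ℝ) where
  N : ℕ
  cell : Fin N → Set ℝ
  interval : ∀ a, (cell a).OrdConnected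
  ordered : ∀ a b, a < b → ∀ x ∈ cell a, ∀ y ∈ cell b, x < y
  cover : ⋃ a, cell a = Set.Icc 0 1
  length_le : ∀ a, ∀ x ∈ cell a, ∀ y ∈ cell a, y - x ≤ δ

open Classical in
/-- The event `1[p_{t,i} ∈ U ∧ q_{t,i}(p_t) ∈ V]`. -/
def levelSetEvent {X : Type*} [MeasurableSpace X] {k : ℕ} (q : Competitor X k) (i : Fin k)
    (U V : Set ℝ) : Event X k :=
  fun t h x p => if p.1 i ∈ U ∧ (q.map t h x p).1 i ∈ V then 1 else 0

/-- The data to which the guarantee applies, with implied constants bounded by `K`: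
`δ = Θ(T^{-1/4})`, every `δ`-partition has `O(1/δ)` cells, and `𝓔` is a family of `O(k|𝓠|/δ²)` events
which includes, for every competing predictor `q` and every coordinate `i`, all the products of the
`δ`-level sets of our predictor with those of `q` in coordinate `i`. -/
structure IncludesLevelSets {X : Type*} [MeasurableSpace X] {k m : ℕ} (K : ℝ) (T : ℕ) (δ : ℝ)
    (q : Fin m → Competitor X k) (Ωp : Fin k → DeltaPartition δ)
    (Ωq : Fin m → Fin k → DeltaPartition δ) (𝓔 : Finset (Event X k)) : Prop where
  delta_lower : K⁻¹ * (T : ℝ) ^ (-(1 / 4) : ℝ) ≤ δ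
  delta_upper : δ ≤ K * (T : ℝ) ^ (-(1 / 4) : ℝ)
  cells_own : ∀ i, ((Ωp i).N : ℝ) ≤ K / δ
  cells_competitor : ∀ j i, ((Ωq j i).N : ℝ) ≤ K / δ
  isEvent : ∀ E ∈ 𝓔, IsEvent E
  card_le : (𝓔.card : ℝ) ≤ K * (k * m / δ ^ 2)
  includes : ∀ j i a b, levelSetEvent (q j) i ((Ωp i).cell a) ((Ωq j i).cell b) ∈ 𝓔

/-! ### Bregman scores -/

/-- The separable Bregman divergence `d_f` generated by `f`. -/
def bregmanDiv {k : ℕ} (f : ℝ → ℝ) (p₁ p₂ : Simplex k) : ℝ :=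
  ∑ i, (f (p₁.1 i) - f (p₂.1 i) - deriv f (p₂.1 i) * (p₁.1 i - p₂.1 i))

/-- `d : Δ𝒴 × ri(Δ𝒴) → ℝ` is a Bregman divergence; its values outside of this domain are
irrelevant. -/
def IsBregmanDivergence {k : ℕ} (d : Simplex k → Simplex k → ℝ) : Prop :=
  ∃ f : ℝ → ℝ, StrictConvexOn ℝ (Set.Icc 0 1) f ∧ DifferentiableOn ℝ f (Set.Ioo 0 1) ∧
    ∀ p₁, ∀ p₂ ∈ riSimplex k, d p₁ p₂ = bregmanDiv f p₁ p₂

/-- The expected score `ℓ(p₁, p₂) = ∑_i p_{2,i} φ(p₁, e_i)` of a scoring rule `φ`. -/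
def expectedScore {k : ℕ} (φ : Simplex k → Fin k → ℝ≥0∞) (p₁ p₂ : Simplex k) : ℝ≥0∞ :=
  ∑ i, ENNReal.ofReal (p₂.1 i) * φ p₁ i

/-- The expected score of `φ` is a Bregman score with associated divergence `d`:
`ℓ(p₁, p₂) - ℓ(p₂, p₂) = d(p₂, p₁)`, where both terms are finite, for all `p₁ ∈ ri(Δ𝒴)` and
`p₂ ∈ Δ𝒴`. -/
def IsBregmanScore {k : ℕ} (φ : Simplex k → Fin k → ℝ≥0∞) (d : Simplex k → Simplex k → ℝ) : Prop :=
  IsBregmanDivergence d ∧ ∀ p₁ ∈ riSimplex k, ∀ p₂,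
    expectedScore φ p₁ p₂ ≠ ∞ ∧ expectedScore φ p₂ p₂ ≠ ∞ ∧
    (expectedScore φ p₁ p₂).toReal - (expectedScore φ p₂ p₂).toReal = d p₂ p₁

/-- `d` is `L`-Lipschitz in its second argument, with respect to the `ℓ¹`-norm. (Of all `ℓ^r`-norms
this one gives the weakest condition.) -/
def LipschitzInSecond {k : ℕ} (L : ℝ) (d : Simplex k → Simplex k → ℝ) : Prop :=
  ∀ p₁, ∀ p₂ ∈ riSimplex k, ∀ p₂' ∈ riSimplex k,
    |d p₁ p₂ - d p₁ p₂'| ≤ L * ∑ i, |p₂.1 i - p₂'.1 i|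

/-- The cumulative loss `∑_t ℓ(r_t, y_t)` of the predictions `r_1, …, r_T` on a transcript. -/
def cumLoss {X : Type*} {k T : ℕ} (φ : Simplex k → Fin k → ℝ≥0∞) (r : Fin T → Simplex k)
    (π : Transcript X k T) : ℝ≥0∞ :=
  ∑ t, expectedScore φ (r t) (oneHot (π t).2.2)

/-- The loss `L_ℓ(p, π_T)` of our own predictions. -/
def ownLoss {X : Type*} {k T : ℕ} (φ : Simplex k → Fin k → ℝ≥0∞) (π : Transcript X k T) : ℝ≥0∞ :=
  cumLoss φ (fun t => (π t).2.1) π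

/-- The loss `L_ℓ(q, π_T)` of a competing predictor. -/
def Competitor.loss {X : Type*} [MeasurableSpace X] {k T : ℕ} (q : Competitor X k)
    (φ : Simplex k → Fin k → ℝ≥0∞) (π : Transcript X k T) : ℝ≥0∞ :=
  cumLoss φ (q.play π) π

/-- Almost surely, all coordinates of our predictions lie in `(0,1)`. -/
def OwnInterior {X : Type*} [MeasurableSpace X] {k : ℕ} (T : ℕ) (A : Learner X k)
    (B : Adversary X k) : Prop :=
  ∀ᵐ π ∂(transcriptLaw A B T), ∀ (t : Fin T) (i : Fin k), (π t).2.1.1 i ∈ Set.Ioo (0 : ℝ) 1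

/-- Almost surely, all coordinates of all predictions of the competing predictors lie in `(0,1)`. -/
def CompetitorsInterior {X : Type*} [MeasurableSpace X] {k m : ℕ} (T : ℕ)
    (q : Fin m → Competitor X k) (A : Learner X k) (B : Adversary X k) : Prop :=
  ∀ᵐ π ∂(transcriptLaw A B T), ∀ (j : Fin m) (t : Fin T) (i : Fin k),
    ((q j).play π t).1 i ∈ Set.Ioo (0 : ℝ) 1

/-- The error term `C · L k √(ln (k m T)) T^{3/4}`, where `m` is the number of competitors. -/
def errorTerm (C L : ℝ) (k m T : ℕ) : ℝ≥0∞ :=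
  ENNReal.ofReal (C * (L * k * √(Real.log (k * m * T)) * (T : ℝ) ^ (3 / 4 : ℝ)))

end Omnipred

end

noncomputable section

namespace Omnipred

/-! ### Bregman scores with Lipschitz divergence -/

/-! For a Bregman score, the loss of `p` minus the loss of `q` at label `y` is `d(y,p) - d(y,q)`.
The terms `f(y_i)` cancel, and the tangent line of `f` at `q_i` bounds the rest by `∑ i, (f'(q_i) -
f'(p_i)) (y_i - p_i)`. A Lipschitz divergence forces `f'` to be `4L`-Lipschitz
(`deriv_sub_deriv_le`), so on each product of level sets the weight `f'(q_i) - f'(p_i)` is within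
`8Lδ` of a constant of size at most `4L`. On every transcript with interior predictions, regret is
therefore at most `4L` times the sum of the absolute biases on the level-set events, plus a rounding
error `16LδT` (`ownLoss_le_loss_add_sum_bias`). The loss enters only through `L`, which makes the
bound simultaneous over all losses.

For a fixed competitor and coordinate there are `O(√T)` level-set events, and exactly one of them
fires in each round, so their second moments sum to `T`. By Cauchy–Schwarz, unbiasedness bounds the
sum of their biases by `O(√T Λ + √Λ T^{3/4})`, and `δ ≈ T^{-1/4}` makes the rounding error `O(L
T^{3/4})`. The term `√T Λ` is of the required order while `ln(kmT) ≤ √T`; beyond that, the trivial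
regret bound `8LT` suffices.

The learner comes from a betting argument. For each event, coordinate, sign and stake `1/(2n)`, a
bettor stakes that fraction of its capital on the bias. If the label distribution were known,
predicting close to it would make every bet almost fair; by minimax, some mixture of predictions
does as well against every label (`exists_mixture_gain_le`). Hence the average wealth `Φ` has
expectation at most `(1 + 1/T)^T ≤ 3`. Since the logarithm of a wealth is at least `±bias/(2n) - (∑
E²)/(4n²)`, the single variable `Φ` controls all biases on every transcript
(`exists_learner_small_bias`). Tuning `n` gives unbiasedness; as `Φ` is common to all competitors,
the minimum over them may be taken inside the expectation. -/

theorem lt_one_of_mem_riSimplex {k : ℕ} (hk : 2 ≤ k) {p : Simplex k} (hp : p ∈ riSimplex k)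
    (i : Fin k) : p.1 i < 1 := by
  have : Nontrivial (Fin k) := Fin.nontrivial_iff_two_le.2 hk
  obtain ⟨j, hj⟩ := exists_ne i
  have h := Finset.add_le_sum (fun l _ => (p.2.1 l)) (Finset.mem_univ i) (Finset.mem_univ j) hj.symm
  rw [p.2.2] at h
  linarith [hp j]

theorem tangent_le_of_convexOn {f : ℝ → ℝ} {S : Set ℝ} (hf : ConvexOn ℝ S f) {x y : ℝ}
    (hx : x ∈ S) (hy : y ∈ S) (hd : DifferentiableAt ℝ f y) :
    f y + deriv f y * (x - y) ≤ f x := by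
  rcases lt_trichotomy x y with h | rfl | h
  · have := hf.slope_le_deriv hx hy h hd
    rw [slope_def_field, div_le_iff₀ (by linarith)] at this
    nlinarith
  · simp
  · have := hf.deriv_le_slope hy hx h hd
    rw [slope_def_field, le_div_iff₀ (by linarith)] at this
    nlinarith

/-- The point of the simplex with coordinate `s` at `a`, coordinate `r` at `b ≠ a` and the
coordinate `c` elsewhere. -/
def twoPoint {k : ℕ} (a b : Fin k) (s r c : ℝ) : Fin k → ℝ :=
  fun i => c + (Pi.single a (s - c) : Fin k → ℝ) i + (Pi.single b (r - c) : Fin k → ℝ) i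

theorem twoPoint_mem {k : ℕ} (a b : Fin k) {s r c : ℝ} (h0 : ∀ i, 0 ≤ twoPoint a b s r c i)
    (h : k * c + (s - c) + (r - c) = 1) : twoPoint a b s r c ∈ stdSimplex ℝ (Fin k) := by
  refine ⟨h0, ?_⟩
  simp only [twoPoint, Finset.sum_add_distrib, Finset.sum_pi_single', Finset.sum_const,
    Finset.card_univ, Fintype.card_fin, nsmul_eq_mul, Finset.mem_univ, if_true]
  simpa using h

/-- Comparing two vertices removes everything in the divergence that depends on `p`, except for two
values of the derivative. -/
theorem bregmanDiv_oneHot_sub {k : ℕ} (f : ℝ → ℝ) (a b : Fin k) (p : Simplex k) :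
    bregmanDiv f (oneHot a) p - bregmanDiv f (oneHot b) p =
      (∑ i, (f ((oneHot a).1 i) - f ((oneHot b).1 i))) - (deriv f (p.1 a) - deriv f (p.1 b)) := by
  have h : deriv f (p.1 a) - deriv f (p.1 b) =
      ∑ i, deriv f (p.1 i) * ((oneHot a).1 i - (oneHot b).1 i) := by
    simp [oneHot, mul_sub, Finset.sum_sub_distrib, Pi.single_apply]
  rw [h, bregmanDiv, bregmanDiv, ← Finset.sum_sub_distrib, ← Finset.sum_sub_distrib]
  exact Finset.sum_congr rfl fun i _ => by ring

/-- Shift mass `s' - s` from coordinate `b` to coordinate `a`. The divergences from the vertices `a`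
and `b` each change by at most `L` times the `ℓ¹`-distance `2(s' - s)`, whence the factor 4. Their
difference records the increase of `deriv f` at `a` plus its decrease at `b`; both are nonnegative
by convexity, so the second can be dropped. -/
theorem deriv_sub_deriv_le {k : ℕ} (hk : 2 ≤ k) {L : ℝ} {f : ℝ → ℝ}
    {d : Simplex k → Simplex k → ℝ} (hf : ConvexOn ℝ (Set.Icc 0 1) f)
    (hdf : DifferentiableOn ℝ f (Set.Ioo 0 1))
    (hd : ∀ p₁, ∀ p₂ ∈ riSimplex k, d p₁ p₂ = bregmanDiv f p₁ p₂) (hL : LipschitzInSecond L d)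
    {s s' : ℝ} (h0 : 0 < s) (hs : s ≤ s') (h1 : s' < 1) :
    deriv f s' - deriv f s ≤ 4 * L * (s' - s) := by
  have hmono : MonotoneOn (deriv f) (Set.Ioo 0 1) :=
    (hf.subset Set.Ioo_subset_Icc_self (convex_Ioo 0 1)).monotoneOn_deriv
      fun x hx => (hdf x hx).differentiableAt (Ioo_mem_nhds hx.1 hx.2)
  have hk0 : (0 : ℝ) < k := by positivity
  have hk2 : (2 : ℝ) ≤ k := by exact_mod_cast hk
  -- With this `c`, the coordinates `s'`, `2c` and `k - 2` copies of `c` are positive and sum to 1.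
  obtain ⟨c, hc⟩ : ∃ c : ℝ, c = (1 - s') / k := ⟨_, rfl⟩
  have hkc : k * c = 1 - s' := by rw [hc]; field_simp
  have hc0 : 0 < c := by rw [hc]; exact div_pos (by linarith) hk0
  let a : Fin k := ⟨0, by omega⟩
  let b : Fin k := ⟨1, by omega⟩
  have hab : a ≠ b := by simp [a, b]
  have hpos : ∀ u r : ℝ, 0 < u → 0 < r → ∀ i, 0 < twoPoint a b u r c i := by
    intro u r hu hr i
    unfold twoPoint
    rcases eq_or_ne i a with rfl | hia
    · simp [hab, hu]
    · rcases eq_or_ne i b with rfl | hib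
      · simp [hab.symm, hr]
      · simp [hia, hib, hc0]
  have hva : ∀ u r : ℝ, twoPoint a b u r c a = u := fun u r => by simp [twoPoint, hab]
  have hvb : ∀ u r : ℝ, twoPoint a b u r c b = r := fun u r => by simp [twoPoint, hab.symm]
  have hr : 0 < 2 * c + s' - s := by linarith
  let p : Simplex k := ⟨twoPoint a b s (2 * c + s' - s) c,
    twoPoint_mem a b (fun i => (hpos _ _ h0 hr i).le) (by linarith)⟩
  let p' : Simplex k := ⟨twoPoint a b s' (2 * c) c,
    twoPoint_mem a b (fun i => (hpos _ _ (by linarith) (by linarith) i).le) (by linarith)⟩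
  have hp : p ∈ riSimplex k := hpos _ _ h0 hr
  have hp' : p' ∈ riSimplex k := hpos _ _ (by linarith) (by linarith)
  have hdist : ∑ i, |p.1 i - p'.1 i| ≤ 2 * (s' - s) := by
    have : ∀ i, |p.1 i - p'.1 i| ≤ (Pi.single a (s' - s) : Fin k → ℝ) i +
        (Pi.single b (s' - s) : Fin k → ℝ) i := by
      intro i
      rcases eq_or_ne i a with rfl | hia
      · simp only [p, p', hva]
        simp [hab, abs_sub_comm s s', abs_of_nonneg (sub_nonneg.2 hs)]
      · rcases eq_or_ne i b with rfl | hib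
        · simp only [p, p', hvb]
          rw [show 2 * c + s' - s - 2 * c = s' - s by ring]
          simp [hab.symm, abs_of_nonneg (sub_nonneg.2 hs)]
        · simp [p, p', twoPoint, hia, hib]
    refine (Finset.sum_le_sum fun i _ => this i).trans (le_of_eq ?_)
    simp [Finset.sum_add_distrib]
    ring
  -- The sign of `L` is not assumed: the Lipschitz bound at two distinct points forces it.
  have hL0 : 0 ≤ L ∨ s = s' := by
    rcases hs.eq_or_lt with h | h
    · exact Or.inr h
    · left
      by_contra! hneg
      have h2 := (abs_nonneg _).trans (hL p p hp p' hp')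
      have h3 : 0 < ∑ i, |p.1 i - p'.1 i| := by
        refine Finset.sum_pos' (fun _ _ => abs_nonneg _) ⟨a, Finset.mem_univ _, ?_⟩
        simp only [p, p', hva]
        exact abs_pos.2 (by linarith)
      nlinarith
  rcases hL0 with hL0 | rfl
  swap
  · simp
  have hA := (hL (oneHot a) p hp p' hp').trans (mul_le_mul_of_nonneg_left hdist hL0)
  have hB := (hL (oneHot b) p hp p' hp').trans (mul_le_mul_of_nonneg_left hdist hL0)
  rw [hd _ p hp, hd _ p' hp'] at hA hB
  have e1 := bregmanDiv_oneHot_sub f a b p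
  have e2 := bregmanDiv_oneHot_sub f a b p'
  have hb : deriv f (2 * c) ≤ deriv f (2 * c + s' - s) :=
    hmono ⟨by linarith, by nlinarith⟩ ⟨hr, by nlinarith⟩ (by linarith)
  simp only [p, p', hva, hvb] at e1 e2 hA hB
  have := abs_le.1 hA
  have := abs_le.1 hB
  linarith

/-- The derivative `g` of the generator of a Bregman score whose divergence is `L`-Lipschitz in
the second argument is `4L`-Lipschitz, and it controls differences of scores. -/
theorem IsBregmanScore.exists_lipschitz {k : ℕ} (hk : 2 ≤ k) {L : ℝ}
    {φ : Simplex k → Fin k → ℝ≥0∞} {d : Simplex k → Simplex k → ℝ} (hφ : IsBregmanScore φ d)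
    (hL : LipschitzInSecond L d) :
    ∃ g : ℝ → ℝ, (∀ s ∈ Set.Ioo (0 : ℝ) 1, ∀ s' ∈ Set.Ioo (0 : ℝ) 1,
        |g s - g s'| ≤ 4 * L * |s - s'|) ∧
      ∀ p ∈ riSimplex k, ∀ q ∈ riSimplex k, ∀ y,
        (expectedScore φ p (oneHot y)).toReal - (expectedScore φ q (oneHot y)).toReal ≤
          ∑ i, (g (q.1 i) - g (p.1 i)) * ((oneHot y).1 i - p.1 i) := by
  obtain ⟨⟨f, hf, hdf, hd⟩, hs⟩ := hφ
  have key : ∀ s s' : ℝ, 0 < s → s ≤ s' → s' < 1 → |deriv f s' - deriv f s| ≤ 4 * L * (s' - s) := by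
    intro s s' h0 h h1
    have hmono : MonotoneOn (deriv f) (Set.Ioo 0 1) :=
      (hf.convexOn.subset Set.Ioo_subset_Icc_self (convex_Ioo 0 1)).monotoneOn_deriv
        fun x hx => (hdf x hx).differentiableAt (Ioo_mem_nhds hx.1 hx.2)
    rw [abs_of_nonneg (sub_nonneg.2 (hmono ⟨h0, by linarith⟩ ⟨by linarith, h1⟩ h))]
    exact deriv_sub_deriv_le hk hf.convexOn hdf hd hL h0 h h1
  refine ⟨deriv f, fun s hs s' hs' => ?_, fun p hp q hq y => ?_⟩
  · rcases le_total s s' with h | h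
    · rw [abs_sub_comm, abs_sub_comm s, abs_of_nonneg (sub_nonneg.2 h)]
      exact key _ _ hs.1 h hs'.2
    · rw [abs_of_nonneg (sub_nonneg.2 h)]
      exact key _ _ hs'.1 h hs.2
  · have h1 := (hs p hp (oneHot y)).2.2
    have h2 := (hs q hq (oneHot y)).2.2
    have h3 : (expectedScore φ p (oneHot y)).toReal - (expectedScore φ q (oneHot y)).toReal =
        d (oneHot y) p - d (oneHot y) q := by linarith
    rw [h3, hd _ _ hp, hd _ _ hq, bregmanDiv, bregmanDiv, ← Finset.sum_sub_distrib]
    refine Finset.sum_le_sum fun i _ => ?_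
    have hqi : q.1 i ∈ Set.Ioo (0 : ℝ) 1 := ⟨hq i, lt_one_of_mem_riSimplex hk hq i⟩
    have hpi : p.1 i ∈ Set.Ioo (0 : ℝ) 1 := ⟨hp i, lt_one_of_mem_riSimplex hk hp i⟩
    -- The tangent at `q_i`, evaluated at `p_i`, replaces `f(q_i) - f(p_i)`; then `f'(q_i)`
    -- multiplies `(q_i - p_i) + (y_i - q_i) = y_i - p_i`.
    have := tangent_le_of_convexOn hf.convexOn (Set.Ioo_subset_Icc_self hpi)
      (Set.Ioo_subset_Icc_self hqi) ((hdf _ hqi).differentiableAt (Ioo_mem_nhds hqi.1 hqi.2))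
    nlinarith

/-! ### Discretization by level sets -/

theorem DeltaPartition.exists_index {δ : ℝ} (P : DeltaPartition δ) {s : ℝ}
    (hs : s ∈ Set.Icc (0 : ℝ) 1) : ∃ a, ∀ b, s ∈ P.cell b ↔ b = a := by
  rw [← P.cover] at hs
  obtain ⟨a, ha⟩ := Set.mem_iUnion.1 hs
  refine ⟨a, fun b => ⟨fun hb => ?_, fun h => h ▸ ha⟩⟩
  rcases lt_trichotomy a b with h | h | h
  · exact absurd (P.ordered a b h s ha s hb) (lt_irrefl _)
  · exact h.symm
  · exact absurd (P.ordered b a h s hb s ha) (lt_irrefl _)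

theorem DeltaPartition.abs_sub_le {δ : ℝ} (P : DeltaPartition δ) {a : Fin P.N} {x y : ℝ}
    (hx : x ∈ P.cell a) (hy : y ∈ P.cell a) : |x - y| ≤ δ :=
  abs_le.2 ⟨by linarith [P.length_le a x hx y hy], P.length_le a y hy x hx⟩

theorem DeltaPartition.N_pos {δ : ℝ} (P : DeltaPartition δ) : 0 < P.N := by
  obtain ⟨a, -⟩ := P.exists_index (s := 0) (by simp)
  exact a.pos

open Classical in
/-- Differences of a Lipschitz function of two discretized quantities, tested against arbitrary
weights, are controlled by the sums of the weights over the products of level sets. -/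
theorem sum_sub_mul_le_of_lipschitz {T : ℕ} {δ M : ℝ} (hM : 0 ≤ M) (P Q : DeltaPartition δ)
    {g : ℝ → ℝ} (hg : ∀ s ∈ Set.Ioo (0 : ℝ) 1, ∀ s' ∈ Set.Ioo (0 : ℝ) 1, |g s - g s'| ≤ M * |s - s'|)
    (s r w : Fin T → ℝ) (hs : ∀ t, s t ∈ Set.Ioo (0 : ℝ) 1) (hr : ∀ t, r t ∈ Set.Ioo (0 : ℝ) 1) :
    ∑ t, (g (r t) - g (s t)) * w t ≤
      M * (∑ a, ∑ b, |∑ t, (if s t ∈ P.cell a ∧ r t ∈ Q.cell b then (1 : ℝ) else 0) * w t|) +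
        ∑ t, 2 * M * δ * |w t| := by
  -- `v a b` is the value of `g y - g x` at representatives of the two cells. Moving `x` and `y`
  -- within their cells costs `M * δ` each. Cells that miss `(0,1)` have no representative and get
  -- the value 0.
  have hv : ∀ a b, ∃ v : ℝ, |v| ≤ M ∧ ∀ x ∈ P.cell a ∩ Set.Ioo 0 1, ∀ y ∈ Q.cell b ∩ Set.Ioo 0 1,
      |g y - g x - v| ≤ 2 * M * δ := by
    intro a b
    by_cases h : (P.cell a ∩ Set.Ioo 0 1).Nonempty ∧ (Q.cell b ∩ Set.Ioo 0 1).Nonempty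
    · obtain ⟨⟨x₀, hx₀⟩, ⟨y₀, hy₀⟩⟩ := h
      refine ⟨g y₀ - g x₀, ?_, fun x hx y hy => ?_⟩
      · refine (hg _ hy₀.2 _ hx₀.2).trans ?_
        have : |y₀ - x₀| ≤ 1 := abs_le.2
          ⟨by linarith [hy₀.2.1, hx₀.2.2], by linarith [hy₀.2.2, hx₀.2.1]⟩
        nlinarith
      · have h1 := (hg _ hy.2 _ hy₀.2).trans
          (mul_le_mul_of_nonneg_left (Q.abs_sub_le hy.1 hy₀.1) hM)
        have h2 := (hg _ hx.2 _ hx₀.2).trans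
          (mul_le_mul_of_nonneg_left (P.abs_sub_le hx.1 hx₀.1) hM)
        rw [abs_le] at *
        constructor <;> linarith
    · refine ⟨0, by simpa using hM, fun x hx y hy => absurd ⟨⟨x, hx⟩, ⟨y, hy⟩⟩ h⟩
  choose v hvM hv using hv
  choose α hα using fun t => P.exists_index (Set.Ioo_subset_Icc_self (hs t))
  choose β hβ using fun t => Q.exists_index (Set.Ioo_subset_Icc_self (hr t))
  -- Each round belongs to exactly one pair of cells, so only `v (α t) (β t)` survives.
  have hsum : ∑ a, ∑ b, v a b *
      ∑ t, (if s t ∈ P.cell a ∧ r t ∈ Q.cell b then (1 : ℝ) else 0) * w t =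
      ∑ t, v (α t) (β t) * w t := by
    simp_rw [Finset.mul_sum]
    rw [Finset.sum_congr rfl fun a _ => Finset.sum_comm, Finset.sum_comm]
    refine Finset.sum_congr rfl fun t _ => ?_
    rw [Finset.sum_eq_single (α t), Finset.sum_eq_single (β t)]
    · simp [hα, hβ]
    · intro b _ hb
      simp [hβ, hb]
    · simp
    · intro a _ ha
      simp [hα, ha]
    · simp
  have h1 : ∑ t, (g (r t) - g (s t)) * w t = (∑ a, ∑ b, v a b *
      ∑ t, (if s t ∈ P.cell a ∧ r t ∈ Q.cell b then (1 : ℝ) else 0) * w t) +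
      ∑ t, (g (r t) - g (s t) - v (α t) (β t)) * w t := by
    rw [hsum, ← Finset.sum_add_distrib]
    exact Finset.sum_congr rfl fun t _ => by ring
  rw [h1, Finset.mul_sum]
  refine add_le_add (Finset.sum_le_sum fun a _ => ?_) (Finset.sum_le_sum fun t _ => ?_)
  · rw [Finset.mul_sum]
    refine Finset.sum_le_sum fun b _ => (le_abs_self _).trans ?_
    rw [abs_mul]
    exact mul_le_mul_of_nonneg_right (hvM a b) (abs_nonneg _)
  · refine (le_abs_self _).trans ?_
    rw [abs_mul]
    exact mul_le_mul_of_nonneg_right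
      (hv _ _ _ ⟨(hα t _).2 rfl, hs t⟩ _ ⟨(hβ t _).2 rfl, hr t⟩) (abs_nonneg _)

theorem sum_abs_oneHot_sub_le {k : ℕ} (y : Fin k) (p : Simplex k) :
    ∑ i, |(oneHot y).1 i - p.1 i| ≤ 2 := by
  have h : ∀ i, |(oneHot y).1 i - p.1 i| ≤ (oneHot y).1 i + p.1 i := fun i => by
    have := (oneHot y).2.1 i
    have := p.2.1 i
    exact abs_le.2 ⟨by linarith, by linarith⟩
  refine (Finset.sum_le_sum fun i _ => h i).trans ?_
  rw [Finset.sum_add_distrib, (oneHot y).2.2, p.2.2]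
  norm_num

theorem abs_sub_oneHot_le_one {k : ℕ} (y : Fin k) (p : Simplex k) (i : Fin k) :
    |p.1 i - (oneHot y).1 i| ≤ 1 := by
  have h1 := mem_Icc_of_mem_stdSimplex (oneHot y).2 i
  have h2 := mem_Icc_of_mem_stdSimplex p.2 i
  exact abs_le.2 ⟨by linarith [h1.2, h2.1], by linarith [h1.1, h2.2]⟩

/-! ### Regret on a fixed transcript -/

section Pathwise

variable {X : Type*} [MeasurableSpace X] {k T : ℕ}

/-- Regret on a transcript is at most the sum over rounds and coordinates of the differences of
the derivatives, weighted with the residuals. -/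
theorem ownLoss_le_loss_add {φ : Simplex k → Fin k → ℝ≥0∞} {d : Simplex k → Simplex k → ℝ}
    (hφ : IsBregmanScore φ d) {g : ℝ → ℝ}
    (hg : ∀ p ∈ riSimplex k, ∀ q ∈ riSimplex k, ∀ y,
        (expectedScore φ p (oneHot y)).toReal - (expectedScore φ q (oneHot y)).toReal ≤
          ∑ i, (g (q.1 i) - g (p.1 i)) * ((oneHot y).1 i - p.1 i))
    (q : Competitor X k) {π : Transcript X k T}
    (hp : ∀ t, (π t).2.1 ∈ riSimplex k) (hq : ∀ t, q.play π t ∈ riSimplex k) {W : ℝ}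
    (hW : ∑ i, ∑ t, (g ((q.play π t).1 i) - g ((π t).2.1.1 i)) *
      ((oneHot (π t).2.2).1 i - (π t).2.1.1 i) ≤ W) :
    ownLoss φ π ≤ q.loss φ π + ENNReal.ofReal W := by
  have fin : ∀ r : Fin T → Simplex k, (∀ t, r t ∈ riSimplex k) → ∀ t ∈ Finset.univ,
      expectedScore φ (r t) (oneHot (π t).2.2) ≠ ∞ := fun r hr t _ => (hφ.2 _ (hr t) _).1
  have key : (ownLoss φ π).toReal ≤ (q.loss φ π).toReal + W := by
    rw [ownLoss, Competitor.loss, cumLoss, cumLoss, ENNReal.toReal_sum (fin _ hp),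
      ENNReal.toReal_sum (fin _ hq), ← sub_le_iff_le_add', ← Finset.sum_sub_distrib]
    refine le_trans (Finset.sum_le_sum fun t _ => hg _ (hp t) _ (hq t) _) ?_
    rw [Finset.sum_comm]
    exact hW
  have f1 : ownLoss φ π ≠ ∞ := ENNReal.sum_ne_top.2 (fin _ hp)
  have f2 : q.loss φ π ≠ ∞ := ENNReal.sum_ne_top.2 (fin _ hq)
  rw [← ENNReal.ofReal_toReal f1, ← ENNReal.ofReal_toReal f2]
  exact (ENNReal.ofReal_le_ofReal key).trans ENNReal.ofReal_add_le

theorem ownLoss_le_loss_add_sum_bias (hk : 2 ≤ k) {L δ : ℝ} (hL : 0 ≤ L) (hδ : 0 ≤ δ)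
    {φ : Simplex k → Fin k → ℝ≥0∞} {d : Simplex k → Simplex k → ℝ}
    (hφ : IsBregmanScore φ d) (hd : LipschitzInSecond L d) (q : Competitor X k)
    (P Q : Fin k → DeltaPartition δ) {π : Transcript X k T}
    (hp : ∀ t, (π t).2.1 ∈ riSimplex k) (hq : ∀ t, q.play π t ∈ riSimplex k) :
    ownLoss φ π ≤ q.loss φ π + ENNReal.ofReal
      (4 * L * (∑ i, ∑ a, ∑ b, |bias (levelSetEvent q i ((P i).cell a) ((Q i).cell b)) i π|) +
        16 * L * δ * T) := by
  obtain ⟨g, hg, hgs⟩ := hφ.exists_lipschitz hk hd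
  refine ownLoss_le_loss_add hφ hgs q hp hq ?_
  refine (Finset.sum_le_sum fun i _ => sum_sub_mul_le_of_lipschitz (M := 4 * L) (by positivity)
    (P i) (Q i) hg (fun t => (π t).2.1.1 i) (fun t => (q.play π t).1 i)
    (fun t => (oneHot (π t).2.2).1 i - (π t).2.1.1 i)
    (fun t => ⟨hp t i, lt_one_of_mem_riSimplex hk (hp t) i⟩)
    (fun t => ⟨hq t i, lt_one_of_mem_riSimplex hk (hq t) i⟩)).trans ?_
  rw [Finset.sum_add_distrib, ← Finset.mul_sum]
  refine add_le_add (le_of_eq ?_) ?_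
  · congr 1
    refine Finset.sum_congr rfl fun i _ => Finset.sum_congr rfl fun a _ =>
      Finset.sum_congr rfl fun b _ => ?_
    rw [bias, ← abs_neg, ← Finset.sum_neg_distrib]
    congr 1
    refine Finset.sum_congr rfl fun t _ => ?_
    rw [← mul_neg, neg_sub]
    rfl
  · rw [Finset.sum_comm]
    calc ∑ t : Fin T, ∑ i, 2 * (4 * L) * δ * |(oneHot (π t).2.2).1 i - (π t).2.1.1 i|
        ≤ ∑ t : Fin T, 2 * (4 * L) * δ * 2 := by
          refine Finset.sum_le_sum fun t _ => ?_
          rw [← Finset.mul_sum]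
          exact mul_le_mul_of_nonneg_left (sum_abs_oneHot_sub_le _ _) (by positivity)
      _ = 16 * L * δ * T := by
          simp
          ring

/-- Each weight is at most `4 * L` and the residuals of a round have `ℓ¹`-norm at most 2. This
covers the regime where the logarithm exceeds `√T`. -/
theorem ownLoss_le_loss_add_trivial (hk : 2 ≤ k) {L : ℝ} (hL : 0 ≤ L)
    {φ : Simplex k → Fin k → ℝ≥0∞} {d : Simplex k → Simplex k → ℝ}
    (hφ : IsBregmanScore φ d) (hd : LipschitzInSecond L d) (q : Competitor X k)
    {π : Transcript X k T}
    (hp : ∀ t, (π t).2.1 ∈ riSimplex k) (hq : ∀ t, q.play π t ∈ riSimplex k) :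
    ownLoss φ π ≤ q.loss φ π + ENNReal.ofReal (8 * L * T) := by
  obtain ⟨g, hg, hgs⟩ := hφ.exists_lipschitz hk hd
  refine ownLoss_le_loss_add hφ hgs q hp hq ?_
  rw [Finset.sum_comm]
  calc ∑ t, ∑ i, (g ((q.play π t).1 i) - g ((π t).2.1.1 i)) *
        ((oneHot (π t).2.2).1 i - (π t).2.1.1 i)
      ≤ ∑ t : Fin T, 4 * L * 2 := by
        refine Finset.sum_le_sum fun t _ => ?_
        refine le_trans ?_ (mul_le_mul_of_nonneg_left (sum_abs_oneHot_sub_le (π t).2.2 (π t).2.1)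
          (by positivity : 0 ≤ 4 * L))
        rw [Finset.mul_sum]
        refine Finset.sum_le_sum fun i _ => (le_abs_self _).trans ?_
        rw [abs_mul]
        refine mul_le_mul_of_nonneg_right ?_ (abs_nonneg _)
        have h1 := hq t i
        have h2 := lt_one_of_mem_riSimplex hk (hq t) i
        have h3 := hp t i
        have h4 := lt_one_of_mem_riSimplex hk (hp t) i
        refine (hg _ ⟨h1, h2⟩ _ ⟨h3, h4⟩).trans ?_
        have : |(q.play π t).1 i - (π t).2.1.1 i| ≤ 1 :=
          abs_le.2 ⟨by linarith, by linarith⟩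
        nlinarith
    _ = 8 * L * T := by
        simp
        ring

/-- The products of cells tile the unit square, so exactly one of these events fires. -/
theorem sum_levelSetEvent_at {δ : ℝ} (q : Competitor X k) (i : Fin k) (P Q : DeltaPartition δ)
    (π : Transcript X k T) (t : Fin T) :
    ∑ a, ∑ b, (levelSetEvent q i (P.cell a) (Q.cell b)).at π t ^ 2 = 1 := by
  classical
  obtain ⟨a₀, ha⟩ := P.exists_index (mem_Icc_of_mem_stdSimplex (π t).2.1.2 i)
  obtain ⟨b₀, hb⟩ := Q.exists_index (mem_Icc_of_mem_stdSimplex (q.play π t).2 i)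
  have h : ∀ a b, (levelSetEvent q i (P.cell a) (Q.cell b)).at π t ^ 2 =
      if a = a₀ ∧ b = b₀ then 1 else 0 := by
    intro a b
    have : (levelSetEvent q i (P.cell a) (Q.cell b)).at π t =
        if (π t).2.1.1 i ∈ P.cell a ∧ (q.play π t).1 i ∈ Q.cell b then 1 else 0 := by
      rw [Event.at, levelSetEvent]
      congr
    rw [this, ha, hb]
    split_ifs <;> simp
  simp_rw [h]
  rw [Finset.sum_eq_single a₀, Finset.sum_eq_single b₀] <;> simp +contextual

end Pathwise

/-! ### Measurability and integrability -/

section Measurability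

variable {X : Type*} [MeasurableSpace X] {k T : ℕ}

theorem measurable_past (t : Fin T) :
    Measurable (fun π : Transcript X k T => (past π t : Transcript X k t)) :=
  measurable_pi_lambda _ fun _ => measurable_pi_apply _

theorem IsEvent.measurable_at {E : Event X k} (hE : IsEvent E) (t : Fin T) :
    Measurable (fun π : Transcript X k T => E.at π t) :=
  (hE.2 t).comp ((measurable_past t).prodMk
    ((measurable_fst.comp (measurable_pi_apply t)).prodMk
      ((measurable_fst.comp measurable_snd).comp (measurable_pi_apply t))))

theorem measurable_residual (t : Fin T) (i : Fin k) :
    Measurable (fun π : Transcript X k T => (π t).2.1.1 i - (oneHot (π t).2.2).1 i) := by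
  have h1 : Measurable (fun p : Simplex k => p.1 i) :=
    (measurable_pi_apply i).comp measurable_subtype_coe
  have h2 : Measurable (fun y : Fin k => (oneHot y).1 i) := measurable_of_countable _
  exact (h1.comp ((measurable_fst.comp measurable_snd).comp (measurable_pi_apply t))).sub
    (h2.comp ((measurable_snd.comp measurable_snd).comp (measurable_pi_apply t)))

theorem IsEvent.measurable_bias {E : Event X k} (hE : IsEvent E) (i : Fin k) :
    Measurable (fun π : Transcript X k T => bias E i π) :=
  Finset.measurable_sum _ fun t _ => (hE.measurable_at t).mul (measurable_residual t i)

theorem IsEvent.abs_term_le {E : Event X k} (hE : IsEvent E) (i : Fin k) (π : Transcript X k T)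
    (t : Fin T) : |E.at π t * ((π t).2.1.1 i - (oneHot (π t).2.2).1 i)| ≤ 1 := by
  have h : E.at π t ∈ Set.Icc (0 : ℝ) 1 := hE.1 t (past π t) (π t).1 (π t).2.1
  rw [abs_mul]
  exact mul_le_one₀ (abs_le.2 ⟨by linarith [h.1], h.2⟩)
    (abs_nonneg _) (abs_sub_oneHot_le_one _ _ _)

theorem IsEvent.integrable_abs_bias {E : Event X k} (hE : IsEvent E) (i : Fin k)
    (μ : Measure (Transcript X k T)) [IsFiniteMeasure μ] :
    Integrable (fun π => |bias E i π|) μ := by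
  refine Integrable.of_bound (C := T) (hE.measurable_bias i).abs.aestronglyMeasurable
    (Filter.Eventually.of_forall fun π => ?_)
  rw [Real.norm_eq_abs, abs_abs]
  refine (Finset.abs_sum_le_sum_abs _ _).trans
    ((Finset.sum_le_sum fun t _ => hE.abs_term_le i π t).trans ?_)
  simp

theorem IsEvent.sq_at_mem {E : Event X k} (hE : IsEvent E) (π : Transcript X k T) (t : Fin T) :
    E.at π t ^ 2 ∈ Set.Icc (0 : ℝ) 1 := by
  have h := hE.1 t (past π t) (π t).1 (π t).2.1
  exact ⟨sq_nonneg _, pow_le_one₀ h.1 h.2⟩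

theorem IsEvent.integrable_sq_at {E : Event X k} (hE : IsEvent E) (t : Fin T)
    (μ : Measure (Transcript X k T)) [IsFiniteMeasure μ] :
    Integrable (fun π => E.at π t ^ 2) μ := by
  refine Integrable.of_bound (C := 1) ((hE.measurable_at t).pow_const 2).aestronglyMeasurable
    (Filter.Eventually.of_forall fun π => ?_)
  rw [Real.norm_eq_abs, abs_of_nonneg (hE.sq_at_mem π t).1]
  exact (hE.sq_at_mem π t).2

theorem IsEvent.integral_sq_at_mem {E : Event X k} (hE : IsEvent E) (t : Fin T)
    (μ : Measure (Transcript X k T)) [IsProbabilityMeasure μ] :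
    ∫ π, E.at π t ^ 2 ∂μ ∈ Set.Icc (0 : ℝ) 1 := by
  refine ⟨integral_nonneg fun π => (hE.sq_at_mem π t).1, ?_⟩
  refine (integral_mono (hE.integrable_sq_at t μ) (integrable_const (1 : ℝ))
    fun π => (hE.sq_at_mem π t).2).trans ?_
  simp

end Measurability

/-- Scoring rules carry no measurability assumption, so `F` and `G` are arbitrary; additivity of the
lower integral needs only the error term `S` to be measurable. -/
theorem lintegral_le_add_ofReal_integral {α : Type*} [MeasurableSpace α] {μ : Measure α}
    {F G : α → ℝ≥0∞} {S : α → ℝ} (hS : Integrable S μ) (hSm : Measurable S) (h0 : ∀ a, 0 ≤ S a)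
    (h : ∀ᵐ a ∂μ, F a ≤ G a + ENNReal.ofReal (S a)) {R : ℝ} (hR : ∫ a, S a ∂μ ≤ R) :
    ∫⁻ a, F a ∂μ ≤ ∫⁻ a, G a ∂μ + ENNReal.ofReal R := by
  refine (lintegral_mono_ae h).trans ?_
  rw [lintegral_add_right _ hSm.ennreal_ofReal,
    ← ofReal_integral_eq_lintegral_ofReal hS (Filter.Eventually.of_forall h0)]
  exact add_le_add_right (ENNReal.ofReal_le_ofReal hR) _

/-! ### Sizes of the data -/

theorem rpow_one_fourth_facts {T : ℕ} (hT : 1 ≤ T) :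
    ∃ u : ℝ, 1 ≤ u ∧ u ^ 4 = T ∧ (T : ℝ) ^ (3 / 4 : ℝ) = u ^ 3 ∧
      (T : ℝ) ^ (-(1 / 4) : ℝ) = u⁻¹ := by
  have hT' : (1 : ℝ) ≤ T := by exact_mod_cast hT
  have h0 : (0 : ℝ) ≤ T := by linarith
  refine ⟨(T : ℝ) ^ (1 / 4 : ℝ), Real.one_le_rpow hT' (by norm_num), ?_, ?_, ?_⟩
  · rw [← Real.rpow_natCast, ← Real.rpow_mul h0]; norm_num
  · rw [← Real.rpow_natCast, ← Real.rpow_mul h0]; norm_num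
  · rw [Real.rpow_neg h0]

theorem log_two_le_log_mul {k m T : ℕ} (hk : 2 ≤ k) (hm : 1 ≤ m) (hT : 1 ≤ T) :
    Real.log 2 ≤ Real.log (k * m * T) := by
  refine Real.log_le_log (by norm_num) ?_
  have : 2 ≤ k * m * T := by
    have := Nat.mul_le_mul (Nat.mul_le_mul hk hm) hT
    simpa using this
  exact_mod_cast this

section Sizes

variable {X : Type*} [MeasurableSpace X] {k m T : ℕ} {K δ : ℝ} {q : Fin m → Competitor X k}
  {Ωp : Fin k → DeltaPartition δ} {Ωq : Fin m → Fin k → DeltaPartition δ}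
  {𝓔 : Finset (Event X k)}

theorem IncludesLevelSets.one_le (h : IncludesLevelSets K T δ q Ωp Ωq 𝓔) (hK : 0 < K)
    (hT : 1 ≤ T) : 1 ≤ K := by
  obtain ⟨u, hu, -, -, hu'⟩ := rpow_one_fourth_facts hT
  have h1 := h.delta_lower.trans h.delta_upper
  rw [hu'] at h1
  have h2 := le_of_mul_le_mul_right h1 (by positivity)
  by_contra! hlt
  have := (one_lt_inv₀ hK).2 hlt
  linarith

theorem IncludesLevelSets.delta_pos (h : IncludesLevelSets K T δ q Ωp Ωq 𝓔) (hK : 0 < K)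
    (hT : 1 ≤ T) : 0 < δ := by
  have : (0 : ℝ) < T := by exact_mod_cast hT
  exact lt_of_lt_of_le (by positivity) h.delta_lower

theorem IncludesLevelSets.card_pos (h : IncludesLevelSets K T δ q Ωp Ωq 𝓔) (hk : 2 ≤ k)
    (hm : 1 ≤ m) : 1 ≤ 𝓔.card :=
  Finset.card_pos.2 ⟨_, h.includes ⟨0, hm⟩ ⟨0, by omega⟩ ⟨0, (Ωp _).N_pos⟩ ⟨0, (Ωq _ _).N_pos⟩⟩

theorem IncludesLevelSets.inv_delta_le (h : IncludesLevelSets K T δ q Ωp Ωq 𝓔) (hK : 0 < K)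
    {u : ℝ} (hu : 1 ≤ u) (hu' : (T : ℝ) ^ (-(1 / 4) : ℝ) = u⁻¹) : δ⁻¹ ≤ K * u := by
  have h1 := h.delta_lower
  rw [hu', ← mul_inv] at h1
  have := inv_anti₀ (by positivity) h1
  rwa [inv_inv] at this

theorem IncludesLevelSets.cells_mul_cells_le (h : IncludesLevelSets K T δ q Ωp Ωq 𝓔) (hK : 0 < K)
    {u : ℝ} (hu : 1 ≤ u) (hu' : (T : ℝ) ^ (-(1 / 4) : ℝ) = u⁻¹) (i : Fin k)
    (j : Fin m) : ((Ωp i).N : ℝ) * (Ωq j i).N ≤ K ^ 4 * u ^ 2 := by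
  have hd := h.inv_delta_le hK hu hu'
  have h1 : ((Ωp i).N : ℝ) ≤ K * (K * u) :=
    (h.cells_own i).trans (by rw [div_eq_mul_inv]; gcongr)
  have h2 : ((Ωq j i).N : ℝ) ≤ K * (K * u) :=
    (h.cells_competitor j i).trans (by rw [div_eq_mul_inv]; gcongr)
  calc ((Ωp i).N : ℝ) * (Ωq j i).N ≤ (K * (K * u)) * (K * (K * u)) := by gcongr
    _ = K ^ 4 * u ^ 2 := by ring

theorem IncludesLevelSets.log_le (h : IncludesLevelSets K T δ q Ωp Ωq 𝓔) (hk : 2 ≤ k)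
    (hm : 1 ≤ m) (hT : 1 ≤ T) (hK : 0 < K) :
    Real.log (2 * k * 𝓔.card * T) ≤
      (Real.log (2 * K ^ 3) / Real.log 2 + 2) * Real.log (k * m * T) := by
  obtain ⟨u, hu, hu4, -, hu'⟩ := rpow_one_fourth_facts hT
  have hK1 := h.one_le hK hT
  have hd := h.inv_delta_le hK hu hu'
  have hδ := h.delta_pos hK hT
  have hl := log_two_le_log_mul hk hm hT
  have hl2 : 0 < Real.log 2 := Real.log_pos (by norm_num)
  have hk' : (1 : ℝ) ≤ k := by exact_mod_cast (by omega : 1 ≤ k)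
  have hm' : (1 : ℝ) ≤ m := by exact_mod_cast hm
  have hT' : (1 : ℝ) ≤ T := by exact_mod_cast hT
  have hE : (1 : ℝ) ≤ 𝓔.card := by exact_mod_cast h.card_pos hk hm
  have hN : (0 : ℝ) < k * m * T := by positivity
  have hc : (𝓔.card : ℝ) ≤ K * (k * m) * (K * u) ^ 2 := by
    refine h.card_le.trans ?_
    calc K * (k * m / δ ^ 2) = K * (k * m) * δ⁻¹ ^ 2 := by field_simp
      _ ≤ _ := by gcongr
  have hu2 : u ^ 2 ≤ T := by
    rw [← hu4]
    exact pow_le_pow_right₀ hu (by norm_num)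
  -- The number of events is polynomial in `k * m * T`: `δ⁻² ≤ (K u)²` with `u² = √T ≤ T`. The
  -- constant `2 * K ^ 3` is later absorbed because the target logarithm is at least `log 2`.
  have h1 : 2 * (k : ℝ) * 𝓔.card * T ≤ 2 * K ^ 3 * (k * m * T) ^ 2 := by
    calc 2 * (k : ℝ) * 𝓔.card * T ≤ 2 * k * (K * (k * m) * (K * u) ^ 2) * T := by gcongr
      _ = 2 * K ^ 3 * (k ^ 2 * m * u ^ 2 * T) := by ring
      _ ≤ 2 * K ^ 3 * (k ^ 2 * m ^ 2 * T * T) := by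
        gcongr
        exact le_self_pow₀ hm' (by norm_num)
      _ = _ := by ring
  have h2 := Real.log_le_log (by positivity) h1
  refine h2.trans ?_
  rw [Real.log_mul (by positivity) (by positivity), Real.log_pow]
  have h3 : 0 ≤ Real.log (2 * K ^ 3) := Real.log_nonneg (by nlinarith [one_le_pow₀ hK1 (n := 3)])
  have h4 : Real.log (2 * K ^ 3) ≤ Real.log (2 * K ^ 3) / Real.log 2 * Real.log (k * m * T) := by
    rw [div_mul_eq_mul_div, le_div_iff₀ hl2]
    exact mul_le_mul_of_nonneg_left hl h3
  push_cast
  linarith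

theorem IncludesLevelSets.one_le_log (h : IncludesLevelSets K T δ q Ωp Ωq 𝓔) (hk : 2 ≤ k)
    (hm : 1 ≤ m) (hT : 1 ≤ T) : 1 ≤ Real.log (2 * k * 𝓔.card * T) := by
  rw [Real.le_log_iff_exp_le]
  · refine Real.exp_one_lt_d9.le.trans ?_
    have hk' : (2 : ℝ) ≤ k := by exact_mod_cast hk
    have hT' : (1 : ℝ) ≤ T := by exact_mod_cast hT
    have hE : (1 : ℝ) ≤ 𝓔.card := by exact_mod_cast h.card_pos hk hm
    have h1 : (1 : ℝ) ≤ 𝓔.card * T := one_le_mul_of_one_le_of_one_le hE hT'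
    nlinarith
  · have : (0 : ℝ) < k := by positivity
    have : (0 : ℝ) < T := by exact_mod_cast hT
    have : (0 : ℝ) < 𝓔.card := by exact_mod_cast h.card_pos hk hm
    positivity

theorem IncludesLevelSets.sum_integral_sq_at_eq (h : IncludesLevelSets K T δ q Ωp Ωq 𝓔)
    (μ : Measure (Transcript X k T)) [IsProbabilityMeasure μ] (j : Fin m) (i : Fin k) :
    ∑ a, ∑ b, ∑ t : Fin T, ∫ π,
      (levelSetEvent (q j) i ((Ωp i).cell a) ((Ωq j i).cell b)).at π t ^ 2 ∂μ = T := by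
  have hint : ∀ a b t, Integrable (fun π : Transcript X k T =>
      (levelSetEvent (q j) i ((Ωp i).cell a) ((Ωq j i).cell b)).at π t ^ 2) μ :=
    fun a b t => (h.isEvent _ (h.includes j i a b)).integrable_sq_at t μ
  rw [Finset.sum_congr rfl fun a _ => Finset.sum_comm, Finset.sum_comm]
  simp_rw [← integral_finsetSum _ fun b _ => hint _ b _]
  simp_rw [← integral_finsetSum Finset.univ fun a _ => integrable_finsetSum Finset.univ
    fun b _ => hint a b _]
  simp [sum_levelSetEvent_at]

end Sizes

/-! ### Unbiased predictions beat every competitor -/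

/-- Cauchy–Schwarz over the cells. -/
theorem sum_sum_sqrt_mul_le {N N' : ℕ} {Λ : ℝ} (hΛ : 0 ≤ Λ) (V : Fin N → Fin N' → ℝ)
    (hV : ∀ a b, 0 ≤ V a b) :
    ∑ a, ∑ b, √(Λ * V a b) ≤ √(N * N' * (Λ * ∑ a, ∑ b, V a b)) := by
  have := Real.sum_sqrt_mul_sqrt_le (Finset.univ : Finset (Fin N × Fin N')) (f := fun _ => 1)
    (g := fun x => Λ * V x.1 x.2) (fun _ => zero_le_one) fun x => mul_nonneg hΛ (hV _ _)
  rw [← Real.sqrt_mul (by positivity)] at this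
  simpa [Fintype.sum_prod_type, ← Finset.mul_sum] using this

section

variable {X : Type*} [MeasurableSpace X] {k m T : ℕ} {K δ : ℝ} {q : Fin m → Competitor X k}
  {Ωp : Fin k → DeltaPartition δ} {Ωq : Fin m → Fin k → DeltaPartition δ}
  {𝓔 : Finset (Event X k)} {A : Learner X k} {B : Adversary X k}

theorem IncludesLevelSets.sum_integral_abs_bias_le (h : IncludesLevelSets K T δ q Ωp Ωq 𝓔)
    (hk : 2 ≤ k) (hm : 1 ≤ m) (hT : 1 ≤ T) {c : ℝ} (hc : 0 ≤ c) (hU : UnbiasedOn c 𝓔 T A B)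
    (j : Fin m) (i : Fin k) :
    ∑ a, ∑ b, ∫ π, |bias (levelSetEvent (q j) i ((Ωp i).cell a) ((Ωq j i).cell b)) i π|
        ∂(transcriptLaw A B T) ≤
      c * ((Ωp i).N * (Ωq j i).N * Real.log (2 * k * 𝓔.card * T) +
        √((Ωp i).N * (Ωq j i).N * (Real.log (2 * k * 𝓔.card * T) * T))) := by
  have hΛ := h.one_le_log hk hm hT
  refine (Finset.sum_le_sum fun a _ => Finset.sum_le_sum fun b _ =>
    hU _ (h.includes j i a b) i).trans ?_
  simp_rw [← Finset.mul_sum, Finset.sum_add_distrib]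
  refine mul_le_mul_of_nonneg_left (add_le_add (by simp [mul_assoc]) ?_) hc
  generalize Real.log (2 * k * 𝓔.card * T) = Λ at hΛ
  rw [← h.sum_integral_sq_at_eq (transcriptLaw A B T) j i]
  exact sum_sum_sqrt_mul_le (zero_le_one.trans hΛ) _ fun a b =>
    Finset.sum_nonneg fun t _ => integral_nonneg fun π => sq_nonneg _

theorem ae_mem_riSimplex (hA : OwnInterior T A B) (hB : CompetitorsInterior T q A B) :
    ∀ᵐ π ∂(transcriptLaw A B T), (∀ t, (π t).2.1 ∈ riSimplex k) ∧
      ∀ j t, (q j).play π t ∈ riSimplex k := by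
  filter_upwards [hA, hB] with π h1 h2
  exact ⟨fun t i => (h1 t i).1, fun j t i => (h2 j t i).1⟩

theorem trivial_le_errorTerm {u l L : ℝ} (hk : 2 ≤ k) (hL : 0 < L) (hu : 1 ≤ u) (hl : u ^ 2 ≤ l) :
    8 * L * u ^ 4 ≤ 8 * (L * k * √l * u ^ 3) := by
  have h1 : u ≤ √l := Real.le_sqrt_of_sq_le hl
  have hk' : (1 : ℝ) ≤ k := by exact_mod_cast (by omega : 1 ≤ k)
  calc 8 * L * u ^ 4 = 8 * (L * 1 * u * u ^ 3) := by ring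
    _ ≤ 8 * (L * k * √l * u ^ 3) := by gcongr

theorem discretization_le_errorTerm {u l L : ℝ} (hk : 2 ≤ k) (hL : 0 < L) (hK : 0 < K)
    (hu : 1 ≤ u) (hl : Real.log 2 ≤ l) (hδ : δ ≤ K * u⁻¹) :
    16 * L * δ * u ^ 4 ≤ 16 * K * (L * k * √l * u ^ 3) := by
  have h1 : (1 / 2 : ℝ) ≤ √l :=
    Real.le_sqrt_of_sq_le (by linarith [Real.log_two_gt_d9])
  have hk' : (2 : ℝ) ≤ k := by exact_mod_cast hk
  calc 16 * L * δ * u ^ 4 ≤ 16 * L * (K * u⁻¹) * u ^ 4 := by gcongr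
    _ = 16 * K * (L * 2 * (1 / 2) * u ^ 3) := by field_simp
    _ ≤ 16 * K * (L * k * √l * u ^ 3) := by gcongr

theorem integrable_sum_abs_bias (h : IncludesLevelSets K T δ q Ωp Ωq 𝓔)
    (μ : Measure (Transcript X k T)) [IsFiniteMeasure μ] (j : Fin m) :
    Integrable (fun π => ∑ i, ∑ a, ∑ b,
      |bias (levelSetEvent (q j) i ((Ωp i).cell a) ((Ωq j i).cell b)) i π|) μ :=
  integrable_finsetSum _ fun i _ => integrable_finsetSum _ fun a _ => integrable_finsetSum _
    fun b _ => (h.isEvent _ (h.includes j i a b)).integrable_abs_bias i μ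

theorem measurable_sum_abs_bias (h : IncludesLevelSets K T δ q Ωp Ωq 𝓔) (j : Fin m) :
    Measurable (fun π : Transcript X k T => ∑ i, ∑ a, ∑ b,
      |bias (levelSetEvent (q j) i ((Ωp i).cell a) ((Ωq j i).cell b)) i π|) :=
  Finset.measurable_sum _ fun i _ => Finset.measurable_sum _ fun a _ => Finset.measurable_sum _
    fun b _ => ((h.isEvent _ (h.includes j i a b)).measurable_bias i).abs

theorem integral_sum_abs_bias (h : IncludesLevelSets K T δ q Ωp Ωq 𝓔)
    (μ : Measure (Transcript X k T)) [IsFiniteMeasure μ] (j : Fin m) :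
    ∫ π, ∑ i, ∑ a, ∑ b,
      |bias (levelSetEvent (q j) i ((Ωp i).cell a) ((Ωq j i).cell b)) i π| ∂μ =
    ∑ i, ∑ a, ∑ b, ∫ π,
      |bias (levelSetEvent (q j) i ((Ωp i).cell a) ((Ωq j i).cell b)) i π| ∂μ := by
  have hint := fun i a b => (h.isEvent _ (h.includes j i a b)).integrable_abs_bias i μ
  rw [integral_finsetSum _ fun i _ => integrable_finsetSum _ fun a _ => integrable_finsetSum _
    fun b _ => hint i a b]
  refine Finset.sum_congr rfl fun i _ => ?_
  rw [integral_finsetSum _ fun a _ => integrable_finsetSum _ fun b _ => hint i a b]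
  exact Finset.sum_congr rfl fun a _ => integral_finsetSum _ fun b _ => hint i a b

/-- Here `u` stands for `T^{1/4}` and `l` for `ln(kmT)`. The hypothesis `l ≤ u ^ 2` gives `u² l ≤ √l
u³`, which reduces the linear term to the order of the square root term. -/
theorem cells_bound_le {c A u l Λ NN : ℝ} (hc : 0 ≤ c) (hA : 0 ≤ A) (hu : 1 ≤ u)
    (hl0 : 0 ≤ l) (hl : l ≤ u ^ 2) (hΛ0 : 0 ≤ Λ) (hΛ : Λ ≤ A * l)
    (hNN : NN ≤ K ^ 4 * u ^ 2) :
    c * (NN * Λ + √(NN * (Λ * u ^ 4))) ≤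
      (c * K ^ 4 * A + c * √A * K ^ 2) * (√l * u ^ 3) := by
  have h1 : √l ≤ u := Real.sqrt_le_iff.2 ⟨by linarith, hl⟩
  have h2 : NN * Λ ≤ K ^ 4 * A * (√l * u ^ 3) := by
    calc NN * Λ ≤ K ^ 4 * u ^ 2 * (A * l) := by gcongr
      _ = K ^ 4 * A * (√l * √l * u ^ 2) := by rw [Real.mul_self_sqrt hl0]; ring
      _ ≤ K ^ 4 * A * (√l * u * u ^ 2) := by gcongr
      _ = _ := by ring
  have h3 : √(NN * (Λ * u ^ 4)) ≤ √A * K ^ 2 * (√l * u ^ 3) := by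
    refine Real.sqrt_le_iff.2 ⟨by positivity, ?_⟩
    calc NN * (Λ * u ^ 4) ≤ K ^ 4 * u ^ 2 * (A * l * u ^ 4) := by gcongr
      _ = (√A * √A) * K ^ 4 * ((√l * √l) * u ^ 6) := by
        rw [Real.mul_self_sqrt hl0, Real.mul_self_sqrt hA]; ring
      _ = _ := by ring
  calc c * (NN * Λ + √(NN * (Λ * u ^ 4)))
      ≤ c * (K ^ 4 * A * (√l * u ^ 3) + √A * K ^ 2 * (√l * u ^ 3)) := by gcongr
    _ = _ := by ring

end

theorem lintegral_ownLoss_le_of_unbiasedOn {c K : ℝ} (hc : 0 < c) (hK : 0 < K) :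
    ∃ C : ℝ, 0 < C ∧
      ∀ (X : Type*) [MeasurableSpace X] (k m T : ℕ), 2 ≤ k → 1 ≤ m → 1 ≤ T →
      ∀ (δ : ℝ) (q : Fin m → Competitor X k) (Ωp : Fin k → DeltaPartition δ)
        (Ωq : Fin m → Fin k → DeltaPartition δ) (𝓔 : Finset (Event X k)),
        IncludesLevelSets K T δ q Ωp Ωq 𝓔 →
      ∀ (A : Learner X k) (B : Adversary X k),
        UnbiasedOn c 𝓔 T A B → OwnInterior T A B → CompetitorsInterior T q A B →
      ∀ (L : ℝ) (φ : Simplex k → Fin k → ENNReal) (d : Simplex k → Simplex k → ℝ),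
        0 < L → IsBregmanScore φ d → LipschitzInSecond L d →
        ∫⁻ π, ownLoss φ π ∂(transcriptLaw A B T) ≤
          (⨅ j, ∫⁻ π, (q j).loss φ π ∂(transcriptLaw A B T)) + errorTerm C L k m T := by
  obtain ⟨a, ha⟩ : ∃ a : ℝ, a = |Real.log (2 * K ^ 3) / Real.log 2 + 2| := ⟨_, rfl⟩
  have ha0 : 0 ≤ a := ha ▸ abs_nonneg _
  refine ⟨4 * (c * K ^ 4 * a + c * √a * K ^ 2) + 16 * K + 8, by positivity, ?_⟩
  intro X _ k m T hk hm hT δ q Ωp Ωq 𝓔 h A B hU hA hB L φ d hL hφ hd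
  rw [ENNReal.iInf_add]
  refine le_iInf fun j => ?_
  obtain ⟨u, hu, hu4, hu3, hu'⟩ := rpow_one_fourth_facts hT
  have hl := log_two_le_log_mul hk hm hT
  have hΛ := (h.log_le hk hm hT hK).trans (mul_le_mul_of_nonneg_right
    (le_abs_self _) ((Real.log_nonneg (by norm_num)).trans hl))
  rw [← ha] at hΛ
  have hae := ae_mem_riSimplex hA hB
  rw [errorTerm, hu3]
  generalize Real.log (k * m * T) = l at *
  have hl0 : 0 ≤ l := (Real.log_nonneg (by norm_num)).trans hl
  have hE : 0 ≤ L * k * √l * u ^ 3 := by positivity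
  -- If `l ≥ √T`, the error term already exceeds the trivial bound `8LT`.
  rcases le_total l (u ^ 2) with hlu | hlu
  · refine lintegral_le_add_ofReal_integral
      (((integrable_sum_abs_bias h _ j).const_mul (4 * L)).add (integrable_const _))
      (((measurable_sum_abs_bias h j).const_mul (4 * L)).add_const (16 * L * δ * T))
      (fun π => add_nonneg (mul_nonneg (by positivity) (Finset.sum_nonneg fun i _ =>
        Finset.sum_nonneg fun a _ => Finset.sum_nonneg fun b _ => abs_nonneg _))
        (mul_nonneg (mul_nonneg (by positivity) (h.delta_pos hK hT).le) (by positivity)))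
      (hae.mono fun π hπ => ownLoss_le_loss_add_sum_bias hk hL.le (h.delta_pos hK hT).le hφ hd
        (q j) Ωp (Ωq j) hπ.1 (hπ.2 j)) ?_
    rw [integral_add' ((integrable_sum_abs_bias h _ j).const_mul (4 * L)) (integrable_const _),
      integral_const_mul, integral_sum_abs_bias h, integral_const, probReal_univ, one_smul]
    have hcell : ∀ i, ∑ a, ∑ b,
        ∫ π, |bias (levelSetEvent (q j) i ((Ωp i).cell a) ((Ωq j i).cell b)) i π|
          ∂(transcriptLaw A B T) ≤
        (c * K ^ 4 * a + c * √a * K ^ 2) * (√l * u ^ 3) := by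
      intro i
      refine (h.sum_integral_abs_bias_le hk hm hT hc.le hU j i).trans ?_
      rw [← hu4] at hΛ ⊢
      refine cells_bound_le hc.le ha0 hu hl0 hlu ?_ hΛ (h.cells_mul_cells_le hK hu hu' i j)
      rw [hu4]
      exact zero_le_one.trans (h.one_le_log hk hm hT)
    have hdisc := discretization_le_errorTerm hk hL hK hu hl (hu' ▸ h.delta_upper)
    rw [hu4] at hdisc
    calc _ ≤ 4 * L * (∑ i : Fin k, (c * K ^ 4 * a + c * √a * K ^ 2) * (√l * u ^ 3)) +
          16 * K * (L * k * √l * u ^ 3) := by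
          gcongr with i
          exact hcell i
      _ = (4 * (c * K ^ 4 * a + c * √a * K ^ 2) + 16 * K) * (L * k * √l * u ^ 3) := by
          simp only [Finset.sum_const, Finset.card_univ, Fintype.card_fin, nsmul_eq_mul]
          ring
      _ ≤ _ := mul_le_mul_of_nonneg_right (by linarith) hE
  · refine lintegral_le_add_ofReal_integral (integrable_const _) measurable_const
      (fun _ => by positivity)
      (hae.mono fun π hπ => ownLoss_le_loss_add_trivial hk hL.le hφ hd (q j) hπ.1 (hπ.2 j)) ?_
    rw [integral_const, probReal_univ, one_smul, ← hu4]
    refine (trivial_le_errorTerm hk hL hu hlu).trans ?_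
    gcongr
    have : 0 ≤ 4 * (c * K ^ 4 * a + c * √a * K ^ 2) + 16 * K := by positivity
    linarith

/-! ### A finite minimax theorem and nets of the simplex -/

/-- Minimax for a finite matrix game: at a saddle point `(w, y)`, the payoff of `w` against any
column is at most that of any row against `y`, and some row holds the latter to `b`. -/
theorem exists_mixture_of_forall_exists {P ι : Type*} [Fintype P] [Nonempty P] [Fintype ι]
    [Nonempty ι] (M : P → ι → ℝ) (b : ℝ)
    (h : ∀ y ∈ stdSimplex ℝ ι, ∃ p, ∑ j, y j * M p j ≤ b) :
    ∃ w ∈ stdSimplex ℝ P, ∀ j, ∑ p, w p * M p j ≤ b := by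
  classical
  have hlin1 : ∀ y : ι → ℝ, IsLinearMap ℝ fun w : P → ℝ => ∑ p, ∑ j, w p * (y j * M p j) :=
    fun y => ⟨fun w w' => by simp [add_mul, Finset.sum_add_distrib],
      fun c w => by simp [mul_assoc, Finset.mul_sum]⟩
  have hlin2 : ∀ w : P → ℝ, IsLinearMap ℝ fun y : ι → ℝ => ∑ p, ∑ j, w p * (y j * M p j) :=
    fun w => ⟨fun y y' => by simp [add_mul, mul_add, Finset.sum_add_distrib],
      fun c w => by simp [mul_assoc, mul_left_comm, Finset.mul_sum]⟩
  obtain ⟨w, hw, y, hy, hwy⟩ := Sion.exists_isSaddlePointOn (X := stdSimplex ℝ P)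
    (Y := stdSimplex ℝ ι) (f := fun w y => ∑ p, ∑ j, w p * (y j * M p j))
    ⟨_, single_mem_stdSimplex ℝ (Classical.arbitrary P)⟩ (convex_stdSimplex ℝ P)
    (isCompact_stdSimplex ℝ P)
    (fun y _ => (Continuous.lowerSemicontinuous (by fun_prop)).lowerSemicontinuousOn _)
    (fun y _ => ((hlin1 y).mk' _).convexOn (convex_stdSimplex ℝ P) |>.quasiconvexOn)
    (convex_stdSimplex ℝ ι) ⟨_, single_mem_stdSimplex ℝ (Classical.arbitrary ι)⟩
    (isCompact_stdSimplex ℝ ι)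
    (fun w _ => (Continuous.upperSemicontinuous (by fun_prop)).upperSemicontinuousOn _)
    (fun w _ => ((hlin2 w).mk' _).concaveOn (convex_stdSimplex ℝ ι) |>.quasiconcaveOn)
  obtain ⟨p, hp⟩ := h y hy
  refine ⟨w, hw, fun j => ?_⟩
  have := hwy _ (single_mem_stdSimplex ℝ p) _ (single_mem_stdSimplex ℝ j)
  simp only [Pi.single_apply, ite_mul, one_mul, zero_mul, mul_ite, mul_zero,
    Finset.sum_ite_eq', Finset.mem_univ, if_true] at this
  refine this.trans (le_trans (le_of_eq ?_) hp)
  rw [Finset.sum_comm]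
  simp

theorem exists_finite_net_riSimplex {k : ℕ} (hk : 1 ≤ k) {ε : ℝ} (hε : 0 < ε) :
    ∃ P : Finset (Simplex k), (∀ p ∈ P, p ∈ riSimplex k) ∧
      ∀ y : Simplex k, ∃ p ∈ P, ∀ i, |p.1 i - y.1 i| ≤ ε := by
  have hk0 : (0 : ℝ) < k := by exact_mod_cast hk
  have hk1 : (1 : ℝ) ≤ k := by exact_mod_cast hk
  have hdense : ∀ y : Simplex k, ∃ p ∈ riSimplex k, y ∈ Metric.ball p ε := by
    intro y
    -- Mixing with the uniform distribution at weight `s < ε` moves a point into the interior and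
    -- changes each coordinate by at most `s`.
    obtain ⟨s, hs0, hs1, hsε⟩ : ∃ s : ℝ, 0 < s ∧ s ≤ 1 ∧ s < ε :=
      ⟨min 1 (ε / 2), by positivity, min_le_left _ _, (min_le_right _ _).trans_lt (by linarith)⟩
    have hpos : ∀ i, 0 < (1 - s) * y.1 i + s / k := fun i =>
      add_pos_of_nonneg_of_pos (mul_nonneg (by linarith) (y.2.1 i)) (by positivity)
    refine ⟨⟨fun i => (1 - s) * y.1 i + s / k, fun i => (hpos i).le, ?_⟩, hpos, ?_⟩
    · rw [Finset.sum_add_distrib, ← Finset.mul_sum, y.2.2]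
      simp
      field_simp
      ring
    · rw [Metric.mem_ball, Subtype.dist_eq]
      refine ((dist_pi_le_iff hs0.le).2 fun i => ?_).trans_lt hsε
      have hy := mem_Icc_of_mem_stdSimplex y.2 i
      have h1 : 1 / (k : ℝ) ≤ 1 := by rw [div_le_one hk0]; exact hk1
      have h2 : 0 ≤ 1 / (k : ℝ) := by positivity
      rw [Real.dist_eq, show y.1 i - ((1 - s) * y.1 i + s / k) = s * (y.1 i - 1 / k) by ring,
        abs_mul, abs_of_pos hs0]
      exact mul_le_of_le_one_right hs0.le (abs_le.2 ⟨by linarith [hy.1], by linarith [hy.2]⟩)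
  obtain ⟨P, hP, hcov⟩ := isCompact_univ.elim_finite_subcover_image (b := riSimplex k)
    (c := fun p => Metric.ball p ε) (fun _ _ => Metric.isOpen_ball)
    (fun y _ => by simpa using hdense y)
  refine ⟨hcov.1.toFinset, fun p hp => hP (by simpa using hp), fun y => ?_⟩
  obtain ⟨p, hp, hy⟩ := Set.mem_iUnion₂.1 (hcov.2 (Set.mem_univ y))
  refine ⟨p, by simpa using hp, fun i => ?_⟩
  rw [← Real.dist_eq]
  exact (dist_le_pi_dist _ _ i).trans (by rw [← Subtype.dist_eq, dist_comm]; exact hy.le)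

/-! ### The potential -/

section Potential

variable {X : Type*} {k : ℕ}

/-- The capital of a bettor who stakes the fraction `ρ` of it on the bias in coordinate `i`
conditional on `E`. -/
def wealth (E : Event X k) (i : Fin k) (ρ : ℝ) {t : ℕ} (π : Transcript X k t) : ℝ :=
  ∏ s, (1 + ρ * (E.at π s * ((π s).2.1.1 i - (oneHot (π s).2.2).1 i)))

theorem wealth_snoc (E : Event X k) (i : Fin k) (ρ : ℝ) {t : ℕ} (π : Transcript X k t)
    (z : Round X k) :
    wealth E i ρ (Fin.snoc (α := fun _ => Round X k) π z : Transcript X k (t + 1)) =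
      wealth E i ρ π *
        (1 + ρ * (E t π z.1 z.2.1 * (z.2.1.1 i - (oneHot z.2.2).1 i))) := by
  have hpast : ∀ s : Fin t, past (Fin.snoc (α := fun _ => Round X k) π z : Transcript X k (t + 1))
      s.castSucc = past π s := by
    intro s
    funext r
    exact Fin.snoc_castSucc (α := fun _ => Round X k) z π (Fin.castLE s.is_lt.le r)
  have hlast : past (Fin.snoc (α := fun _ => Round X k) π z : Transcript X k (t + 1))
      (Fin.last t) = π := by
    funext r
    exact Fin.snoc_castSucc (α := fun _ => Round X k) z π r
  rw [wealth, Fin.prod_univ_castSucc, wealth]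
  congr 1
  · refine Finset.prod_congr rfl fun s _ => ?_
    simp only [Event.at, hpast, Fin.snoc_castSucc]
    rfl
  · simp only [Event.at, hlast, Fin.snoc_last]
    rfl

variable [MeasurableSpace X]

theorem wealth_term_pos {E : Event X k} (hE : IsEvent E) (i : Fin k) {ρ : ℝ} (hρ : |ρ| ≤ 1 / 2)
    {t : ℕ} (π : Transcript X k t) (s : Fin t) :
    -(1 / 2) ≤ ρ * (E.at π s * ((π s).2.1.1 i - (oneHot (π s).2.2).1 i)) := by
  have h := hE.abs_term_le i π s
  have : |ρ * (E.at π s * ((π s).2.1.1 i - (oneHot (π s).2.2).1 i))| ≤ 1 / 2 * 1 := by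
    rw [abs_mul]
    gcongr
  linarith [(abs_le.1 this).1]

theorem wealth_pos {E : Event X k} (hE : IsEvent E) (i : Fin k) {ρ : ℝ} (hρ : |ρ| ≤ 1 / 2)
    {t : ℕ} (π : Transcript X k t) : 0 < wealth E i ρ π :=
  Finset.prod_pos fun s _ => by linarith [wealth_term_pos hE i hρ π s]

theorem measurable_wealth {E : Event X k} (hE : IsEvent E) (i : Fin k) (ρ : ℝ) (t : ℕ) :
    Measurable (fun π : Transcript X k t => wealth E i ρ π) :=
  Finset.measurable_prod _ fun s _ =>
    (((hE.measurable_at s).mul (measurable_residual s i)).const_mul ρ).const_add 1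

theorem sub_sq_le_log_one_add {x : ℝ} (hx : -(1 / 2) ≤ x) : x - x ^ 2 ≤ Real.log (1 + x) := by
  have h0 : 0 < 1 + x := by linarith
  rcases le_total 0 x with h | h
  · have h1 := Real.one_sub_inv_le_log_of_pos h0
    refine le_trans ?_ h1
    rw [le_sub_iff_add_le, ← le_sub_iff_add_le', inv_le_iff_one_le_mul₀ h0]
    nlinarith [pow_nonneg h 3]
  · have hv : 0 ≤ x ^ 2 - x := by nlinarith
    rw [Real.le_log_iff_exp_le h0, show x - x ^ 2 = -(x ^ 2 - x) by ring, Real.exp_neg,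
      inv_le_iff_one_le_mul₀ (Real.exp_pos _)]
    refine le_trans ?_ (mul_le_mul_of_nonneg_left (Real.quadratic_le_exp_of_nonneg hv) h0.le)
    have h1 : 0 ≤ x ^ 2 * (1 + x - x ^ 2 + x ^ 3) :=
      mul_nonneg (sq_nonneg x) (by nlinarith [mul_nonneg (sq_nonneg x) h0.le])
    nlinarith

/-- A large bias makes the bettor rich: apply `log (1 + x) ≥ x - x²` to each factor, which is
legitimate for stakes at most `1/2`. -/
theorem log_wealth_ge {E : Event X k} (hE : IsEvent E) (i : Fin k) {ρ : ℝ} (hρ : |ρ| ≤ 1 / 2)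
    {t : ℕ} (π : Transcript X k t) :
    ρ * bias E i π - ρ ^ 2 * ∑ s, E.at π s ^ 2 ≤ Real.log (wealth E i ρ π) := by
  rw [wealth, Real.log_prod fun s _ => by linarith [wealth_term_pos hE i hρ π s], bias,
    Finset.mul_sum, Finset.mul_sum, ← Finset.sum_sub_distrib]
  refine Finset.sum_le_sum fun s _ => le_trans ?_
    (sub_sq_le_log_one_add (wealth_term_pos hE i hρ π s))
  have h1 : (E.at π s * ((π s).2.1.1 i - (oneHot (π s).2.2).1 i)) ^ 2 ≤ E.at π s ^ 2 := by
    rw [mul_pow]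
    exact mul_le_of_le_one_right (sq_nonneg _)
      ((sq_le_one_iff_abs_le_one _).2 (abs_sub_oneHot_le_one _ _ _))
  nlinarith [mul_le_mul_of_nonneg_left h1 (sq_nonneg ρ)]

end Potential

/-! ### A learner that keeps the total wealth of finitely many bettors small -/

theorem measurableSet_riSimplex {k : ℕ} : MeasurableSet (riSimplex k) := by
  rw [riSimplex, Set.ofPred_forall]
  exact MeasurableSet.iInter fun i => measurableSet_lt measurable_const
    ((measurable_pi_apply i).comp measurable_subtype_coe)

section Learner

variable {X : Type*} {k : ℕ} {ι : Type*} [Fintype ι] (Ev : ι → Event X k) (co : ι → Fin k)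
  (ρ : ι → ℝ)

def totalWealth {t : ℕ} (π : Transcript X k t) : ℝ := ∑ e, wealth (Ev e) (co e) (ρ e) π

/-- The increment of the total wealth if `p` is predicted and the label is `y`. -/
def gain {t : ℕ} (h : Transcript X k t) (x : X) (p : Simplex k) (y : Fin k) : ℝ :=
  ∑ e, wealth (Ev e) (co e) (ρ e) h *
    (ρ e * (Ev e t h x p * (p.1 (co e) - (oneHot y).1 (co e))))

theorem totalWealth_snoc {t : ℕ} (h : Transcript X k t) (z : Round X k) :
    totalWealth Ev co ρ (Fin.snoc (α := fun _ => Round X k) h z : Transcript X k (t + 1)) =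
      totalWealth Ev co ρ h + gain Ev co ρ h z.1 z.2.1 z.2.2 := by
  simp only [totalWealth, gain, wealth_snoc, ← Finset.sum_add_distrib]
  exact Finset.sum_congr rfl fun e _ => by ring

theorem sum_mul_gain {t : ℕ} (h : Transcript X k t) (x : X) (p : Simplex k) {y : Fin k → ℝ}
    (hy : y ∈ stdSimplex ℝ (Fin k)) :
    ∑ j, y j * gain Ev co ρ h x p j = ∑ e, wealth (Ev e) (co e) (ρ e) h *
      (ρ e * (Ev e t h x p * (p.1 (co e) - y (co e)))) := by
  simp only [gain, Finset.mul_sum]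
  rw [Finset.sum_comm]
  refine Finset.sum_congr rfl fun e _ => ?_
  have h1 : ∑ j, y j * (p.1 (co e) - (oneHot j).1 (co e)) = p.1 (co e) - y (co e) := by
    simp [oneHot, mul_sub, Finset.sum_sub_distrib, ← Finset.sum_mul, hy.2, Pi.single_apply]
  rw [← h1]
  simp only [Finset.mul_sum]
  exact Finset.sum_congr rfl fun j _ => by ring

variable [MeasurableSpace X]

variable {Ev ρ}

theorem totalWealth_pos [Nonempty ι] (hEv : ∀ e, IsEvent (Ev e)) (hρ : ∀ e, |ρ e| ≤ 1 / 2) {t : ℕ}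
    (π : Transcript X k t) : 0 < totalWealth Ev co ρ π :=
  Finset.sum_pos (fun e _ => wealth_pos (hEv e) (co e) (hρ e) π) Finset.univ_nonempty

theorem measurable_totalWealth (hEv : ∀ e, IsEvent (Ev e)) (t : ℕ) :
    Measurable (fun π : Transcript X k t => totalWealth Ev co ρ π) :=
  Finset.measurable_sum _ fun e _ => measurable_wealth (hEv e) (co e) (ρ e) t

theorem measurable_gain (hEv : ∀ e, IsEvent (Ev e)) (t : ℕ) (p : Simplex k) (y : Fin k) :
    Measurable (fun a : Transcript X k t × X => gain Ev co ρ a.1 a.2 p y) := by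
  refine Finset.measurable_sum _ fun e _ =>
    ((measurable_wealth (hEv e) (co e) (ρ e) t).comp measurable_fst).mul
      (Measurable.const_mul (Measurable.mul_const ?_ _) _)
  exact ((hEv e).2 t).comp (measurable_fst.prodMk (measurable_snd.prodMk measurable_const))

/-- Against a known label distribution `y`, a net point within `ε` of `y` makes every bettor's
expected gain at most `1/2 * ε` times its capital. Minimax turns this into one mixture that is good
against every label. -/
theorem exists_mixture_gain_le (hk : 2 ≤ k) (hEv : ∀ e, IsEvent (Ev e)) (hρ : ∀ e, |ρ e| ≤ 1 / 2)
    {ε : ℝ} {P : Finset (Simplex k)} [Nonempty P]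
    (hP : ∀ y : Simplex k, ∃ p ∈ P, ∀ i, |p.1 i - y.1 i| ≤ ε) {t : ℕ} (h : Transcript X k t)
    (x : X) :
    ∃ w ∈ stdSimplex ℝ P, ∀ y, ∑ p : P, w p * gain Ev co ρ h x p y ≤
      1 / 2 * ε * totalWealth Ev co ρ h := by
  have : Nonempty (Fin k) := ⟨⟨0, by omega⟩⟩
  refine exists_mixture_of_forall_exists (fun (p : P) y => gain Ev co ρ h x p y) _ fun y hy => ?_
  obtain ⟨p, hp, hpy⟩ := hP ⟨y, hy⟩
  refine ⟨⟨p, hp⟩, ?_⟩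
  rw [sum_mul_gain Ev co ρ h x p hy, totalWealth, Finset.mul_sum]
  refine Finset.sum_le_sum fun e _ => ?_
  rw [mul_comm (1 / 2 * ε)]
  refine mul_le_mul_of_nonneg_left ((le_abs_self _).trans ?_)
    (wealth_pos (hEv e) (co e) (hρ e) h).le
  have h1 := (hEv e).1 t h x p
  rw [abs_mul, abs_mul, abs_of_nonneg h1.1]
  refine mul_le_mul (hρ e) ?_ (mul_nonneg h1.1 (abs_nonneg _)) (by norm_num)
  exact (mul_le_of_le_one_left (abs_nonneg _) h1.2).trans (hpy _)

variable [Nonempty ι]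

/-- The mixture can be chosen from a fixed sequence, with an index that depends measurably on the
past and the context. -/
theorem exists_measurable_mixture (hk : 2 ≤ k) (hEv : ∀ e, IsEvent (Ev e))
    (hρ : ∀ e, |ρ e| ≤ 1 / 2) {ε : ℝ} (hε : 0 < ε) {P : Finset (Simplex k)} [Nonempty P]
    (hP : ∀ y : Simplex k, ∃ p ∈ P, ∀ i, |p.1 i - y.1 i| ≤ ε) :
    ∃ W : ℕ → stdSimplex ℝ P, ∀ t, ∃ n : Transcript X k t × X → ℕ, Measurable n ∧
      ∀ a y, ∑ p : P, (W (n a)).1 p * gain Ev co ρ a.1 a.2 p y ≤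
        ε * totalWealth Ev co ρ a.1 := by
  classical
  have : Nonempty (stdSimplex ℝ P) := ⟨⟨_, single_mem_stdSimplex ℝ (Classical.arbitrary P)⟩⟩
  refine ⟨TopologicalSpace.denseSeq (stdSimplex ℝ P), fun t => ?_⟩
  have hex : ∀ a : Transcript X k t × X, ∃ n, ∀ y,
      ∑ p : P, (TopologicalSpace.denseSeq (stdSimplex ℝ P) n).1 p * gain Ev co ρ a.1 a.2 p y ≤
        ε * totalWealth Ev co ρ a.1 := by
    intro a
    obtain ⟨w, hw, hwy⟩ := exists_mixture_gain_le co hk hEv hρ hP a.1 a.2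
    have hpos := totalWealth_pos co hEv hρ a.1
    -- Relaxing `1/2 * ε` to `ε` makes the good mixtures a nonempty open set, as the total wealth is
    -- positive. It meets the dense sequence, and the first index that works is measurable.
    have hopen : IsOpen {v : stdSimplex ℝ P | ∀ y, ∑ p : P, v.1 p * gain Ev co ρ a.1 a.2 p y <
        ε * totalWealth Ev co ρ a.1} := by
      rw [Set.ofPred_forall]
      refine isOpen_iInter_of_finite fun y => isOpen_lt ?_ continuous_const
      exact continuous_finsetSum _ fun p _ =>
        ((continuous_apply p).comp continuous_subtype_val).mul continuous_const
    obtain ⟨n, hn⟩ := (TopologicalSpace.denseRange_denseSeq (stdSimplex ℝ P)).exists_mem_open hopen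
      ⟨⟨w, hw⟩, fun y => (hwy y).trans_lt (by nlinarith [mul_pos hε hpos])⟩
    exact ⟨n, fun y => (hn y).le⟩
  refine ⟨fun a => Nat.find (hex a), measurable_find hex fun n => ?_, fun a => Nat.find_spec (hex a)⟩
  rw [Set.ofPred_forall]
  refine MeasurableSet.iInter fun y => measurableSet_le ?_ ?_
  · exact Finset.measurable_sum _ fun p _ => (measurable_gain co hEv t p y).const_mul _
  · exact ((measurable_totalWealth co hEv t).comp measurable_fst).const_mul _

theorem exists_learner_pred (hk : 2 ≤ k) (hEv : ∀ e, IsEvent (Ev e))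
    (hρ : ∀ e, |ρ e| ≤ 1 / 2) {ε : ℝ} (hε : 0 < ε) :
    ∃ A : Learner X k, (∀ t a, ∀ᵐ p ∂(A.pred t a), p ∈ riSimplex k) ∧
      ∀ (t : ℕ) (h : Transcript X k t) (x : X) (y : Fin k),
        ∫⁻ p, ENNReal.ofReal (totalWealth Ev co ρ
          (Fin.snoc (α := fun _ => Round X k) h (x, p, y) : Transcript X k (t + 1)))
            ∂(A.pred t (h, x)) ≤ ENNReal.ofReal ((1 + ε) * totalWealth Ev co ρ h) := by
  obtain ⟨P, hPri, hP⟩ := exists_finite_net_riSimplex (k := k) (by omega) hε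
  have : Nonempty P := by
    obtain ⟨p, hp, -⟩ := hP (oneHot ⟨0, by omega⟩)
    exact ⟨⟨p, hp⟩⟩
  obtain ⟨W, hW⟩ := exists_measurable_mixture (ρ := ρ) co hk hEv hρ hε hP
  choose n hn hgain using hW
  -- Passing through an index in `ℕ` makes measurability of the kernel automatic.
  let κ : Kernel ℕ (Simplex k) := Kernel.ofFunOfCountable fun j =>
    ∑ p : P, ENNReal.ofReal ((W j).1 p) • Measure.dirac (p : Simplex k)
  have hκ : ∀ j, κ j = ∑ p : P, ENNReal.ofReal ((W j).1 p) • Measure.dirac (p : Simplex k) :=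
    fun _ => rfl
  have : IsMarkovKernel κ := ⟨fun j => ⟨by
    rw [hκ]
    simp only [Measure.coe_finsetSum, Finset.sum_apply, Measure.smul_apply, measure_univ,
      smul_eq_mul, mul_one]
    rw [← ENNReal.ofReal_sum_of_nonneg fun p _ => (W j).2.1 p, (W j).2.2, ENNReal.ofReal_one]⟩⟩
  refine ⟨⟨fun t => κ.comap (n t) (hn t), fun t => inferInstance⟩, fun t a => ?_,
    fun t h x y => ?_⟩
  · rw [Kernel.comap_apply, hκ]
    refine (ae_finsetSum_measure_iff).2 fun p _ => Measure.ae_smul_measure ?_ _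
    exact (ae_dirac_iff measurableSet_riSimplex).2 (hPri _ p.2)
  · rw [Kernel.comap_apply, hκ, lintegral_finsetSum_measure]
    have hw := (W (n t (h, x))).2
    calc ∑ p : P, ∫⁻ p, ENNReal.ofReal (totalWealth Ev co ρ
          (Fin.snoc (α := fun _ => Round X k) h (x, p, y) : Transcript X k (t + 1)))
            ∂(ENNReal.ofReal ((W (n t (h, x))).1 p) • Measure.dirac (p : Simplex k))
        = ∑ p : P, ENNReal.ofReal ((W (n t (h, x))).1 p * (totalWealth Ev co ρ h +
            gain Ev co ρ h x p y)) := by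
          refine Finset.sum_congr rfl fun p _ => ?_
          rw [lintegral_smul_measure, lintegral_dirac, totalWealth_snoc, smul_eq_mul,
            ENNReal.ofReal_mul (hw.1 p)]
      _ = ENNReal.ofReal (∑ p : P, (W (n t (h, x))).1 p * (totalWealth Ev co ρ h +
            gain Ev co ρ h x p y)) := by
          refine (ENNReal.ofReal_sum_of_nonneg fun p _ => mul_nonneg (hw.1 p) ?_).symm
          rw [← totalWealth_snoc Ev co ρ h (x, p, y)]
          exact (totalWealth_pos co hEv hρ _).le
      _ ≤ ENNReal.ofReal ((1 + ε) * totalWealth Ev co ρ h) := by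
          refine ENNReal.ofReal_le_ofReal ?_
          simp only [mul_add, Finset.sum_add_distrib, ← Finset.sum_mul]
          rw [hw.2]
          linarith [hgain t (h, x) y]

end Learner

/-! ### Integration over transcripts round by round -/

section WealthLaw

variable {X : Type*} [MeasurableSpace X] {k : ℕ}

/-- The prediction is integrated innermost, with the label fixed. This is where conditional
independence of prediction and label enters: the learner's guarantee holds for each label
separately. -/
theorem lintegral_roundKernel (A : Learner X k) (B : Adversary X k) (t : ℕ)
    (h : Transcript X k t) {F : Round X k → ℝ≥0∞} (hF : Measurable F) :
    ∫⁻ z, F z ∂(roundKernel A B t h) =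
      ∫⁻ x, ∫⁻ y, ∫⁻ p, F (x, p, y) ∂(A.pred t (h, x)) ∂(B.label t (h, x)) ∂(B.context t h) := by
  have := A.markov t
  have := B.context_markov t
  have := B.label_markov t
  rw [roundKernel, Kernel.lintegral_compProd _ _ _ hF]
  refine lintegral_congr fun x => ?_
  exact Kernel.lintegral_prod_symm _ _ _ (hF.comp measurable_prodMk_left)

theorem lintegral_transcriptLaw_succ (A : Learner X k) (B : Adversary X k) (T : ℕ)
    {F : Transcript X k (T + 1) → ℝ≥0∞} (hF : Measurable F) :
    ∫⁻ π, F π ∂(transcriptLaw A B (T + 1)) =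
      ∫⁻ h, ∫⁻ z, F (Fin.snoc (α := fun _ => Round X k) h z) ∂(roundKernel A B T h)
        ∂(transcriptLaw A B T) := by
  rw [transcriptLaw, lintegral_map hF (measurable_snoc T)]
  exact Measure.lintegral_compProd (hF.comp (measurable_snoc T))

theorem measurable_snoc_right {T : ℕ} (h : Transcript X k T) :
    Measurable (fun z : Round X k =>
      (Fin.snoc (α := fun _ => Round X k) h z : Transcript X k (T + 1))) :=
  (measurable_snoc T).comp measurable_prodMk_left

variable {ι : Type*} [Fintype ι] {Ev : ι → Event X k} {co : ι → Fin k} {ρ : ι → ℝ}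

theorem lintegral_totalWealth_le (hEv : ∀ e, IsEvent (Ev e)) {ε : ℝ} (hε : 0 ≤ ε)
    {A : Learner X k}
    (hA : ∀ (t : ℕ) (h : Transcript X k t) (x : X) (y : Fin k),
        ∫⁻ p, ENNReal.ofReal (totalWealth Ev co ρ
          (Fin.snoc (α := fun _ => Round X k) h (x, p, y) : Transcript X k (t + 1)))
            ∂(A.pred t (h, x)) ≤ ENNReal.ofReal ((1 + ε) * totalWealth Ev co ρ h))
    (B : Adversary X k) (T : ℕ) :
    ∫⁻ π, ENNReal.ofReal (totalWealth Ev co ρ π) ∂(transcriptLaw A B T) ≤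
      ENNReal.ofReal ((1 + ε) ^ T * Fintype.card ι) := by
  have hm : ∀ t, Measurable fun π : Transcript X k t => ENNReal.ofReal (totalWealth Ev co ρ π) :=
    fun t => (measurable_totalWealth co hEv t).ennreal_ofReal
  induction T with
  | zero =>
    rw [transcriptLaw, lintegral_dirac' _ (hm 0)]
    simp [totalWealth, wealth]
  | succ T ih =>
    rw [lintegral_transcriptLaw_succ A B T (hm _)]
    calc _ ≤ ∫⁻ h, ENNReal.ofReal ((1 + ε) * totalWealth Ev co ρ h) ∂(transcriptLaw A B T) := by
          refine lintegral_mono fun h => ?_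
          have := B.context_markov T
          have := B.label_markov T
          refine (lintegral_roundKernel A B T h
            ((hm _).comp (measurable_snoc_right h))).trans_le ?_
          exact (lintegral_mono (g := fun _ => ENNReal.ofReal ((1 + ε) * totalWealth Ev co ρ h))
            fun x => (lintegral_mono fun y => hA T h x y).trans (by simp)).trans (by simp)
      _ = ENNReal.ofReal (1 + ε) * ∫⁻ h, ENNReal.ofReal (totalWealth Ev co ρ h)
            ∂(transcriptLaw A B T) := by
          rw [← lintegral_const_mul _ (hm T)]
          exact lintegral_congr fun h => ENNReal.ofReal_mul (by linarith)
      _ ≤ ENNReal.ofReal (1 + ε) * ENNReal.ofReal ((1 + ε) ^ T * Fintype.card ι) := by gcongr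
      _ = _ := by
          rw [← ENNReal.ofReal_mul (by linarith)]
          congr 1
          ring

theorem ae_forall_mem_riSimplex {A : Learner X k}
    (hA : ∀ t a, ∀ᵐ p ∂(A.pred t a), p ∈ riSimplex k) (B : Adversary X k) (T : ℕ) :
    ∀ᵐ π ∂(transcriptLaw A B T), ∀ t, (π t).2.1 ∈ riSimplex k := by
  have hms : ∀ T, MeasurableSet {π : Transcript X k T | ∀ t, (π t).2.1 ∈ riSimplex k} := by
    intro T
    rw [Set.ofPred_forall]
    exact MeasurableSet.iInter fun t => measurableSet_riSimplex.preimage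
      ((measurable_fst.comp measurable_snd).comp (measurable_pi_apply t))
  induction T with
  | zero => exact Filter.Eventually.of_forall fun π t => t.elim0
  | succ T ih =>
    change transcriptLaw A B (T + 1) {π | ∀ t, (π t).2.1 ∈ riSimplex k}ᶜ = 0
    rw [← lintegral_indicator_one (hms (T + 1)).compl,
      lintegral_transcriptLaw_succ A B T (measurable_one.indicator (hms _).compl)]
    refine (lintegral_congr_ae (g := fun _ => 0) ?_).trans lintegral_zero
    filter_upwards [ih] with h hh
    have := B.label_markov T
    refine (lintegral_roundKernel A B T h
      ((measurable_one.indicator (hms _).compl).comp (measurable_snoc_right h))).trans ?_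
    refine (lintegral_congr fun x => (lintegral_congr fun y => ?_).trans lintegral_zero).trans
      lintegral_zero
    refine (lintegral_congr_ae (g := fun _ => 0) ?_).trans lintegral_zero
    filter_upwards [hA T (h, x)] with p hp
    have hgood : (Fin.snoc (α := fun _ => Round X k) h (x, p, y) : Transcript X k (T + 1)) ∈
        {π : Transcript X k (T + 1) | ∀ t, (π t).2.1 ∈ riSimplex k} := by
      intro t
      refine Fin.lastCases ?_ (fun s => ?_) t
      · simpa using hp
      · simpa using hh s
    exact Set.indicator_of_notMem (Set.notMem_compl_iff.2 hgood) _

end WealthLaw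

/-- There is a learner such that, against every adversary, all biases are simultaneously small in
terms of one random variable with bounded expectation. -/
theorem exists_learner_small_bias {X : Type*} [MeasurableSpace X] {k T : ℕ} (hk : 2 ≤ k)
    (hT : 1 ≤ T) {𝓔 : Finset (Event X k)} (hcard : 1 ≤ 𝓔.card) (h𝓔 : ∀ E ∈ 𝓔, IsEvent E) :
    ∃ A : Learner X k, ∀ B : Adversary X k, OwnInterior T A B ∧
      ∃ Φ : Transcript X k T → ℝ, Measurable Φ ∧ (∀ π, 0 ≤ Φ π) ∧
        Integrable Φ (transcriptLaw A B T) ∧ ∫ π, Φ π ∂(transcriptLaw A B T) ≤ 3 ∧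
        ∀ π, ∀ E ∈ 𝓔, ∀ i, ∀ n : ℕ, 1 ≤ n → n ≤ T →
          |bias E i π| ≤ 2 * n * (Real.log (2 * k * 𝓔.card * T) + Φ π) +
            (∑ t, E.at π t ^ 2) / (2 * n) := by
  let ι := 𝓔 × Fin k × Bool × Fin T
  let Ev : ι → Event X k := fun e => e.1.1
  let co : ι → Fin k := fun e => e.2.1
  -- The stakes are `±1/(2n)` for `n = 1, …, T`; the index in `Fin T` is `n - 1`.
  let ρ : ι → ℝ := fun e => (if e.2.2.1 then 1 else -1) * (1 / (2 * ((e.2.2.2 : ℕ) + 1)))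
  have hEv : ∀ e, IsEvent (Ev e) := fun e => h𝓔 _ e.1.2
  have hρ : ∀ e, |ρ e| ≤ 1 / 2 := by
    intro e
    have h1 : |(if e.2.2.1 then 1 else -1 : ℝ)| = 1 := by split_ifs <;> simp
    rw [abs_mul, h1, one_mul, abs_of_nonneg (by positivity)]
    refine one_div_le_one_div_of_le (by norm_num) ?_
    have : (0 : ℝ) ≤ (e.2.2.2 : ℕ) := Nat.cast_nonneg _
    linarith
  have hT0 : (0 : ℝ) < T := by exact_mod_cast hT
  obtain ⟨E₀, hE₀⟩ := Finset.card_pos.1 hcard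
  have : Nonempty ι := ⟨⟨⟨E₀, hE₀⟩, ⟨0, by omega⟩, true, ⟨0, hT⟩⟩⟩
  have hN : (Fintype.card ι : ℝ) = 2 * k * 𝓔.card * T := by
    simp [ι]
    ring
  have hN0 : (0 : ℝ) < Fintype.card ι := by exact_mod_cast Fintype.card_pos
  -- With `ε = 1/T`, the growth `(1 + ε) ^ T` over all rounds stays below `e`.
  obtain ⟨A, hA1, hA2⟩ := exists_learner_pred (ρ := ρ) co hk hEv hρ (one_div_pos.2 hT0)
  refine ⟨A, fun B => ⟨?_, fun π => totalWealth Ev co ρ π / Fintype.card ι,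
    (measurable_totalWealth co hEv T).div_const _,
    fun π => div_nonneg (totalWealth_pos co hEv hρ π).le hN0.le, ?_⟩⟩
  · filter_upwards [ae_forall_mem_riSimplex hA1 B T] with π hπ t i
    exact ⟨hπ t i, lt_one_of_mem_riSimplex hk (hπ t) i⟩
  have hle := lintegral_totalWealth_le hEv (by positivity) hA2 B T
  have hnn : 0 ≤ᵐ[transcriptLaw A B T] fun π => totalWealth Ev co ρ π :=
    Filter.Eventually.of_forall fun π => (totalWealth_pos co hEv hρ π).le
  have hmeas := (measurable_totalWealth (ρ := ρ) co hEv T).aestronglyMeasurable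
    (μ := transcriptLaw A B T)
  have hint : Integrable (fun π => totalWealth Ev co ρ π) (transcriptLaw A B T) :=
    (lintegral_ofReal_ne_top_iff_integrable hmeas hnn).1
      (ne_top_of_le_ne_top ENNReal.ofReal_ne_top hle)
  refine ⟨hint.div_const _, ?_, ?_⟩
  · rw [integral_div, div_le_iff₀ hN0, integral_eq_lintegral_of_nonneg_ae hnn hmeas]
    refine (ENNReal.toReal_le_of_le_ofReal (by positivity) hle).trans ?_
    gcongr
    calc (1 + 1 / (T : ℝ)) ^ T ≤ Real.exp (1 / T) ^ T := by
          gcongr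
          rw [add_comm]
          exact Real.add_one_le_exp _
      _ = Real.exp 1 := by
          rw [← Real.exp_nat_mul]
          congr 1
          field_simp
      _ ≤ 3 := Real.exp_one_lt_d9.le.trans (by norm_num)
  · intro π E hE i n hn hnT
    have hn0 : (0 : ℝ) < n := by exact_mod_cast hn
    have key : ∀ σ : Bool, (if σ then 1 else -1 : ℝ) * bias E i π ≤
        2 * n * (Real.log (2 * k * 𝓔.card * T) + totalWealth Ev co ρ π / Fintype.card ι) +
            (∑ t, E.at π t ^ 2) / (2 * n) := by
      intro σ
      let e : ι := ⟨⟨E, hE⟩, i, σ, ⟨n - 1, by omega⟩⟩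
      have hρe : ρ e = (if σ then 1 else -1 : ℝ) * (1 / (2 * n)) := by
        simp only [ρ, e]
        rw [Nat.cast_sub hn]
        simp
      have h1 := log_wealth_ge (hEv e) i (hρ e) π
      have h2 : wealth (Ev e) i (ρ e) π ≤ totalWealth Ev co ρ π :=
        Finset.single_le_sum (f := fun e => wealth (Ev e) (co e) (ρ e) π)
          (fun e _ => (wealth_pos (hEv e) (co e) (hρ e) π).le) (Finset.mem_univ e)
      have h3 := h1.trans (Real.log_le_log (wealth_pos (hEv e) i (hρ e) π) h2)
      have hpos := totalWealth_pos co hEv hρ π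
      -- Linearizing the logarithm at the number of bettors yields a quantity whose expectation is
      -- controlled by that of the wealth itself.
      have h4 : Real.log (totalWealth Ev co ρ π) ≤
          Real.log (Fintype.card ι) + totalWealth Ev co ρ π / Fintype.card ι := by
        have h5 := Real.log_le_sub_one_of_pos (div_pos hpos hN0)
        rw [Real.log_div hpos.ne' hN0.ne'] at h5
        linarith
      have hσ : (if σ then 1 else -1 : ℝ) ^ 2 = 1 := by split_ifs <;> norm_num
      have h6 := h3.trans h4
      rw [hρe, mul_pow, hσ, one_mul, hN] at h6
      change _ * (1 / (2 * n)) * bias E i π - _ * ∑ s, E.at π s ^ 2 ≤ _ at h6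
      rw [hN]
      have h7 := mul_le_mul_of_nonneg_left h6 (by positivity : (0 : ℝ) ≤ 2 * n)
      have e1 : 2 * (n : ℝ) * ((if σ then 1 else -1 : ℝ) * (1 / (2 * n)) * bias E i π -
          (1 / (2 * n)) ^ 2 * ∑ s, E.at π s ^ 2) =
          (if σ then 1 else -1 : ℝ) * bias E i π - (∑ s, E.at π s ^ 2) / (2 * n) := by
        field_simp
      linarith
    have ht := key true
    have hf := key false
    simp only [if_true, one_mul, Bool.false_eq_true, if_false, neg_mul] at ht hf
    exact abs_le.2 ⟨by linarith, ht⟩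

/-! ### The learner is unbiased and beats the best competitor in hindsight -/

section SmallBias

variable {X : Type*} [MeasurableSpace X] {k m T : ℕ} {K δ : ℝ} {q : Fin m → Competitor X k}
  {Ωp : Fin k → DeltaPartition δ} {Ωq : Fin m → Fin k → DeltaPartition δ}
  {𝓔 : Finset (Event X k)} {A : Learner X k} {B : Adversary X k}

theorem unbiasedOn_of_small_bias (hT : 1 ≤ T) (h𝓔 : ∀ E ∈ 𝓔, IsEvent E)
    (hΛ : 1 ≤ Real.log (2 * k * 𝓔.card * T)) {Φ : Transcript X k T → ℝ}
    (hΦi : Integrable Φ (transcriptLaw A B T)) (hΦ : ∫ π, Φ π ∂(transcriptLaw A B T) ≤ 3)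
    (hbias : ∀ π, ∀ E ∈ 𝓔, ∀ i, ∀ n : ℕ, 1 ≤ n → n ≤ T →
      |bias E i π| ≤ 2 * n * (Real.log (2 * k * 𝓔.card * T) + Φ π) +
        (∑ t, E.at π t ^ 2) / (2 * n)) :
    UnbiasedOn 9 𝓔 T A B := by
  intro E hE i
  generalize Real.log (2 * k * 𝓔.card * T) = Λ at hΛ hbias ⊢
  obtain ⟨V, hV⟩ : ∃ V, V = ∑ t : Fin T, ∫ π, (E.at π t) ^ 2 ∂(transcriptLaw A B T) := ⟨_, rfl⟩
  rw [← hV]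
  have hmem := fun t => (h𝓔 E hE).integral_sq_at_mem t (transcriptLaw A B T)
  have hV0 : 0 ≤ V := hV ▸ Finset.sum_nonneg fun t _ => (hmem t).1
  have hVT : V ≤ T := by
    rw [hV]
    exact (Finset.sum_le_sum fun t _ => (hmem t).2).trans (by simp)
  have hT' : (1 : ℝ) ≤ T := by exact_mod_cast hT
  -- `s = √(V / Λ)` balances `n * Λ` against `V / n`. It is rounded up to an admissible integer `n`;
  -- `s ≤ T` because `V ≤ T` and `1 ≤ Λ`.
  obtain ⟨s, hs⟩ : ∃ s, s = √(V / Λ) := ⟨_, rfl⟩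
  have hs0 : 0 ≤ s := hs ▸ Real.sqrt_nonneg _
  have hs2 : s * s = V / Λ := by rw [hs, Real.mul_self_sqrt (by positivity)]
  have hVs : V = s * s * Λ := by rw [hs2]; field_simp
  have hsV : √(Λ * V) = s * Λ := by
    rw [hVs, show Λ * (s * s * Λ) = (s * Λ) ^ 2 by ring, Real.sqrt_sq (by positivity)]
  have hsT : s ≤ T := by
    rw [hs]
    refine Real.sqrt_le_iff.2 ⟨by linarith, ?_⟩
    refine (div_le_self hV0 hΛ).trans (hVT.trans ?_)
    nlinarith
  obtain ⟨n, hn1, hnT, hsn, hns⟩ : ∃ n : ℕ, 1 ≤ n ∧ n ≤ T ∧ s ≤ n ∧ (n : ℝ) ≤ s + 1 := by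
    refine ⟨max 1 ⌈s⌉₊, le_max_left _ _, max_le hT (Nat.ceil_le.2 hsT), ?_, ?_⟩
    · exact (Nat.le_ceil s).trans (by exact_mod_cast le_max_right _ _)
    · push_cast
      exact max_le (by linarith) (Nat.ceil_lt_add_one hs0).le
  have hn0 : (0 : ℝ) < n := by exact_mod_cast hn1
  have hsq : Integrable (fun π => ∑ t, E.at π t ^ 2) (transcriptLaw A B T) :=
    integrable_finsetSum _ fun t _ => (h𝓔 E hE).integrable_sq_at t _
  have hi1 : Integrable (fun π => 2 * n * (Λ + Φ π)) (transcriptLaw A B T) :=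
    ((integrable_const _).add hΦi).const_mul _
  have h1 : ∫ π, |bias E i π| ∂(transcriptLaw A B T) ≤
      2 * n * (Λ + ∫ π, Φ π ∂(transcriptLaw A B T)) + V / (2 * n) := by
    refine (integral_mono ((h𝓔 E hE).integrable_abs_bias i _) (hi1.add (hsq.div_const _))
      fun π => hbias π E hE i n hn1 hnT).trans (le_of_eq ?_)
    simp only [Pi.add_apply]
    rw [integral_add hi1 (hsq.div_const _), integral_const_mul,
      integral_add (integrable_const _) hΦi, integral_const, probReal_univ, one_smul,
      integral_div, integral_finsetSum _ fun t _ => (h𝓔 E hE).integrable_sq_at t _, hV]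
  have h2 : V / (2 * n) ≤ s * Λ := by
    rw [div_le_iff₀ (by positivity), hVs]
    have : 0 ≤ s * Λ := by positivity
    nlinarith
  rw [hsV]
  calc ∫ π, |bias E i π| ∂(transcriptLaw A B T) ≤ 2 * n * (Λ + 3) + s * Λ := by
        refine h1.trans ?_
        gcongr
    _ ≤ 2 * (s + 1) * (4 * Λ) + s * Λ := by
        gcongr
        linarith
    _ ≤ 9 * (Λ + s * Λ) := by nlinarith

theorem sum_abs_bias_le_of_small_bias (h : IncludesLevelSets K T δ q Ωp Ωq 𝓔) {n : ℕ} {b M : ℝ}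
    (hb : 0 ≤ b) {π : Transcript X k T}
    (hbias : ∀ E ∈ 𝓔, ∀ i, |bias E i π| ≤ b + (∑ t, E.at π t ^ 2) / (2 * n))
    (hM : ∀ i j, ((Ωp i).N : ℝ) * (Ωq j i).N ≤ M) (j : Fin m) :
    ∑ i, ∑ a, ∑ b, |bias (levelSetEvent (q j) i ((Ωp i).cell a) ((Ωq j i).cell b)) i π| ≤
      k * (M * b + T / (2 * n)) := by
  have hi : ∀ i, ∑ a, ∑ b,
      |bias (levelSetEvent (q j) i ((Ωp i).cell a) ((Ωq j i).cell b)) i π| ≤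
        M * b + T / (2 * n) := by
    intro i
    refine (Finset.sum_le_sum fun a _ => Finset.sum_le_sum fun b _ =>
      hbias _ (h.includes j i a b) i).trans ?_
    have hT : ∑ a, ∑ b, ∑ t,
        (levelSetEvent (q j) i ((Ωp i).cell a) ((Ωq j i).cell b)).at π t ^ 2 = T := by
      rw [Finset.sum_congr rfl fun a _ => Finset.sum_comm, Finset.sum_comm]
      simp [sum_levelSetEvent_at]
    simp_rw [Finset.sum_add_distrib, ← Finset.sum_div]
    rw [hT]
    gcongr
    simp only [Finset.sum_const, Finset.card_univ, Fintype.card_fin, nsmul_eq_mul]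
    rw [← mul_assoc]
    exact mul_le_mul_of_nonneg_right (hM i j) hb
  refine (Finset.sum_le_sum fun i _ => hi i).trans (le_of_eq ?_)
  rw [Finset.sum_const, Finset.card_univ, Fintype.card_fin, nsmul_eq_mul]

end SmallBias

/-- Summing the pathwise bias bound over the cells of one coordinate gives terms of order `u² n l`
and `u⁴ / n`, which balance at `n ≈ u / √l`. -/
theorem exists_rate {u l : ℝ} {T : ℕ} (hu : 1 ≤ u) (hu4 : u ^ 4 = T) (hl : Real.log 2 ≤ l)
    (hlu : l ≤ u ^ 2) :
    ∃ n : ℕ, 1 ≤ n ∧ n ≤ T ∧ n * √l ≤ u ∧ u ≤ 2 * n * √l := by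
  have hl2 : (1 / 2 : ℝ) < l := by linarith [Real.log_two_gt_d9]
  have hl0 : 0 < √l := Real.sqrt_pos.2 (by linarith)
  have h1 : √l ≤ u := Real.sqrt_le_iff.2 ⟨by linarith, hlu⟩
  have h2 : 1 ≤ u / √l := (one_le_div hl0).2 h1
  have hn1 : 1 ≤ ⌊u / √l⌋₊ := Nat.one_le_floor_iff _ |>.2 h2
  have hle : ⌊u / √l⌋₊ * √l ≤ u := by
    rw [← le_div_iff₀ hl0]
    exact Nat.floor_le (by linarith)
  have hn1' : (1 : ℝ) ≤ ⌊u / √l⌋₊ := by exact_mod_cast hn1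
  refine ⟨⌊u / √l⌋₊, hn1, ?_, hle, ?_⟩
  · generalize ⌊u / √l⌋₊ = n at *
    -- Since `l` may be below 1, `n` may exceed `u`. Still `n⁴ ≤ 4T`, and this rules out `n > T`,
    -- where `n ≥ 2` gives `n⁴ ≥ 8n`.
    have h3 : (n : ℝ) ^ 2 * (1 / 2) ≤ u ^ 2 := by
      calc (n : ℝ) ^ 2 * (1 / 2) ≤ n ^ 2 * l := by gcongr
        _ = (n * √l) ^ 2 := by rw [mul_pow, Real.sq_sqrt (by linarith)]
        _ ≤ u ^ 2 := by gcongr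
    have h4 : (n : ℝ) ^ 4 ≤ 4 * T := by
      rw [← hu4]
      nlinarith [pow_le_pow_left₀ (by positivity) h3 2]
    have h5 : n ^ 4 ≤ 4 * T := by exact_mod_cast h4
    by_contra! hlt
    have hn2 : 2 ≤ n := by
      have : 1 ≤ T := by
        have : (1 : ℝ) ≤ T := hu4 ▸ one_le_pow₀ hu
        exact_mod_cast this
      omega
    have h6 : 2 ^ 3 ≤ n ^ 3 := Nat.pow_le_pow_left hn2 3
    nlinarith
  · have := (Nat.lt_floor_add_one (u / √l)).le
    rw [div_le_iff₀ hl0] at this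
    nlinarith

theorem regret_bound_le {u l a K Λ n Φ : ℝ} (ha : 0 ≤ a) (hu : 1 ≤ u) (hl : Real.log 2 ≤ l)
    (hn : 1 ≤ n) (hnu : n * √l ≤ u) (hun : u ≤ 2 * n * √l) (hΛ : Λ ≤ a * l) (hΦ : Φ ≤ 3) :
    K ^ 4 * u ^ 2 * (2 * n * (Λ + Φ)) + u ^ 4 / (2 * n) ≤
      (2 * (a + 6) * K ^ 4 + 1) * (√l * u ^ 3) := by
  have hl2 : (1 / 2 : ℝ) < l := by linarith [Real.log_two_gt_d9]
  have h1 : Λ + Φ ≤ (a + 6) * l := by nlinarith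
  have hsq : √l * √l = l := Real.mul_self_sqrt (by linarith)
  have h2 : K ^ 4 * u ^ 2 * (2 * n * (Λ + Φ)) ≤ 2 * (a + 6) * K ^ 4 * (√l * u ^ 3) := by
    calc K ^ 4 * u ^ 2 * (2 * n * (Λ + Φ)) ≤ K ^ 4 * u ^ 2 * (2 * n * ((a + 6) * l)) := by gcongr
      _ = 2 * (a + 6) * K ^ 4 * (n * l * u ^ 2) := by ring
      _ = 2 * (a + 6) * K ^ 4 * (√l * (n * √l) * u ^ 2) := by
        rw [show √l * (n * √l) = n * (√l * √l) by ring, hsq]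
      _ ≤ 2 * (a + 6) * K ^ 4 * (√l * u * u ^ 2) := by gcongr
      _ = _ := by ring
  have h3 : u ^ 4 / (2 * n) ≤ √l * u ^ 3 := by
    rw [div_le_iff₀ (by positivity)]
    calc u ^ 4 = u * u ^ 3 := by ring
      _ ≤ (2 * n * √l) * u ^ 3 := by gcongr
      _ = _ := by ring
  linarith

theorem exists_learner_unbiasedOn_lintegral_ownLoss_le {K : ℝ} (hK : 0 < K) :
    ∃ C : ℝ, 0 < C ∧
      ∀ (X : Type*) [MeasurableSpace X] (k m T : ℕ), 2 ≤ k → 1 ≤ m → 1 ≤ T →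
      ∀ (δ : ℝ) (q : Fin m → Competitor X k) (Ωp : Fin k → DeltaPartition δ)
        (Ωq : Fin m → Fin k → DeltaPartition δ) (𝓔 : Finset (Event X k)),
        IncludesLevelSets K T δ q Ωp Ωq 𝓔 →
      ∃ A : Learner X k, ∀ B : Adversary X k,
        UnbiasedOn 9 𝓔 T A B ∧ OwnInterior T A B ∧
        (CompetitorsInterior T q A B →
          ∀ (L : ℝ) (φ : Simplex k → Fin k → ENNReal) (d : Simplex k → Simplex k → ℝ),
            0 < L → IsBregmanScore φ d → LipschitzInSecond L d →
            ∫⁻ π, ownLoss φ π ∂(transcriptLaw A B T) ≤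
              ∫⁻ π, (⨅ j, (q j).loss φ π) ∂(transcriptLaw A B T) + errorTerm C L k m T) := by
  obtain ⟨a, ha⟩ : ∃ a : ℝ, a = |Real.log (2 * K ^ 3) / Real.log 2 + 2| := ⟨_, rfl⟩
  have ha0 : 0 ≤ a := ha ▸ abs_nonneg _
  refine ⟨4 * (2 * (a + 6) * K ^ 4 + 1) + 16 * K + 8, by positivity, ?_⟩
  intro X _ k m T hk hm hT δ q Ωp Ωq 𝓔 h
  have hΛ1 := h.one_le_log hk hm hT
  obtain ⟨A, hA⟩ := exists_learner_small_bias hk hT (h.card_pos hk hm) h.isEvent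
  refine ⟨A, fun B => ?_⟩
  obtain ⟨hown, Φ, hΦm, hΦ0, hΦi, hΦ3, hbias⟩ := hA B
  refine ⟨unbiasedOn_of_small_bias hT h.isEvent hΛ1 hΦi hΦ3 hbias, hown, ?_⟩
  intro hcomp L φ d hL hφ hd
  obtain ⟨u, hu, hu4, hu3, hu'⟩ := rpow_one_fourth_facts hT
  have hl := log_two_le_log_mul hk hm hT
  have hΛ := (h.log_le hk hm hT hK).trans (mul_le_mul_of_nonneg_right
    (le_abs_self _) ((Real.log_nonneg (by norm_num)).trans hl))
  rw [← ha] at hΛ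
  have hae := ae_mem_riSimplex hown hcomp
  have hδ := h.delta_pos hK hT
  rw [errorTerm, hu3]
  generalize Real.log (2 * k * 𝓔.card * T) = Λ at *
  generalize Real.log (k * m * T) = l at *
  have hE : 0 ≤ L * k * √l * u ^ 3 := by positivity
  rcases le_total l (u ^ 2) with hlu | hlu
  -- The rate `n` depends neither on the transcript nor on the competitor. The resulting error is
  -- affine in `Φ` and the same for every `j`, so the infimum stays inside the integral.
  · obtain ⟨n, hn1, hnT, hnu, hun⟩ := exists_rate hu hu4 hl hlu
    have hn1' : (1 : ℝ) ≤ n := by exact_mod_cast hn1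
    have hb : ∀ π, 0 ≤ 2 * n * (Λ + Φ π) := fun π =>
      mul_nonneg (by positivity) (by linarith [hΦ0 π])
    have hi0 : Integrable (fun π => K ^ 4 * u ^ 2 * (2 * n * (Λ + Φ π))) (transcriptLaw A B T) :=
      (((integrable_const _).add hΦi).const_mul _).const_mul _
    have hi1 : Integrable (fun π => K ^ 4 * u ^ 2 * (2 * n * (Λ + Φ π)) + T / (2 * n))
        (transcriptLaw A B T) := hi0.add (integrable_const _)
    refine lintegral_le_add_ofReal_integral
      (S := fun π => 4 * L * (k * (K ^ 4 * u ^ 2 * (2 * n * (Λ + Φ π)) + T / (2 * n))) +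
        16 * L * δ * T)
      (((hi1.const_mul _).const_mul _).add (integrable_const _))
      (by fun_prop) (fun π => ?_) (hae.mono fun π hπ => ?_) ?_
    · have := hb π
      positivity
    · rw [ENNReal.iInf_add]
      refine le_iInf fun j => ?_
      refine (ownLoss_le_loss_add_sum_bias hk hL.le hδ.le hφ hd (q j) Ωp (Ωq j) hπ.1
        (hπ.2 j)).trans ?_
      gcongr
      exact sum_abs_bias_le_of_small_bias h (hb π)
        (fun E hE i => hbias π E hE i n hn1 hnT) (fun i j => h.cells_mul_cells_le hK hu hu' i j) j
    · rw [integral_add ((hi1.const_mul _).const_mul _) (integrable_const _),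
        integral_const_mul, integral_const_mul,
        integral_add hi0 (integrable_const _), integral_const_mul, integral_const_mul,
        integral_add (integrable_const _) hΦi]
      simp only [integral_const, probReal_univ, one_smul]
      have hdisc := discretization_le_errorTerm hk hL hK hu hl (hu' ▸ h.delta_upper)
      have hreg := regret_bound_le (K := K) ha0 hu hl hn1' hnu hun hΛ hΦ3
      rw [hu4] at hdisc hreg
      calc _ ≤ 4 * L * (k * ((2 * (a + 6) * K ^ 4 + 1) * (√l * u ^ 3))) +
            16 * K * (L * k * √l * u ^ 3) := by gcongr
        _ = (4 * (2 * (a + 6) * K ^ 4 + 1) + 16 * K) * (L * k * √l * u ^ 3) := by ring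
        _ ≤ _ := mul_le_mul_of_nonneg_right (by linarith) hE
  · refine lintegral_le_add_ofReal_integral (S := fun _ => 8 * L * T) (integrable_const _)
      measurable_const (fun _ => by positivity) (hae.mono fun π hπ => ?_) ?_
    · rw [ENNReal.iInf_add]
      exact le_iInf fun j => ownLoss_le_loss_add_trivial hk hL.le hφ hd (q j) hπ.1 (hπ.2 j)
    · rw [integral_const, probReal_univ, one_smul, ← hu4]
      refine (trivial_le_errorTerm hk hL hu hlu).trans (mul_le_mul_of_nonneg_right ?_ hE)
      have : 0 ≤ 4 * (2 * (a + 6) * K ^ 4 + 1) + 16 * K := by positivity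
      linarith

end Omnipred

end

theorem mainTheorem3 :
    -- every predictor that is unbiased conditional on the products of level sets
    (∀ c K : ℝ, 0 < c → 0 < K → ∃ C : ℝ, 0 < C ∧
      ∀ (X : Type*) [MeasurableSpace X] (k m T : ℕ), 2 ≤ k → 1 ≤ m → 1 ≤ T →
      ∀ (δ : ℝ) (q : Fin m → Omnipred.Competitor X k) (Ωp : Fin k → Omnipred.DeltaPartition δ)
        (Ωq : Fin m → Fin k → Omnipred.DeltaPartition δ) (𝓔 : Finset (Omnipred.Event X k)),
        Omnipred.IncludesLevelSets K T δ q Ωp Ωq 𝓔 →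
      ∀ (A : Omnipred.Learner X k) (B : Omnipred.Adversary X k),
        Omnipred.UnbiasedOn c 𝓔 T A B →
        Omnipred.OwnInterior T A B → Omnipred.CompetitorsInterior T q A B →
      ∀ (L : ℝ) (φ : Omnipred.Simplex k → Fin k → ENNReal)
        (d : Omnipred.Simplex k → Omnipred.Simplex k → ℝ),
        0 < L → Omnipred.IsBregmanScore φ d → Omnipred.LipschitzInSecond L d →
        ∫⁻ π, Omnipred.ownLoss φ π ∂(Omnipred.transcriptLaw A B T) ≤
          (⨅ j, ∫⁻ π, (q j).loss φ π ∂(Omnipred.transcriptLaw A B T)) +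
            Omnipred.errorTerm C L k m T) ∧
    -- such a predictor exists, and it even competes with the best predictor in hindsight
    (∃ c : ℝ, 0 < c ∧ ∀ K : ℝ, 0 < K → ∃ C : ℝ, 0 < C ∧
      ∀ (X : Type*) [MeasurableSpace X] (k m T : ℕ), 2 ≤ k → 1 ≤ m → 1 ≤ T →
      ∀ (δ : ℝ) (q : Fin m → Omnipred.Competitor X k) (Ωp : Fin k → Omnipred.DeltaPartition δ)
        (Ωq : Fin m → Fin k → Omnipred.DeltaPartition δ) (𝓔 : Finset (Omnipred.Event X k)),
        Omnipred.IncludesLevelSets K T δ q Ωp Ωq 𝓔 →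
      ∃ A : Omnipred.Learner X k, ∀ B : Omnipred.Adversary X k,
        Omnipred.UnbiasedOn c 𝓔 T A B ∧ Omnipred.OwnInterior T A B ∧
        (Omnipred.CompetitorsInterior T q A B →
          ∀ (L : ℝ) (φ : Omnipred.Simplex k → Fin k → ENNReal)
            (d : Omnipred.Simplex k → Omnipred.Simplex k → ℝ),
            0 < L → Omnipred.IsBregmanScore φ d → Omnipred.LipschitzInSecond L d →
            ∫⁻ π, Omnipred.ownLoss φ π ∂(Omnipred.transcriptLaw A B T) ≤
              ∫⁻ π, (⨅ j, (q j).loss φ π) ∂(Omnipred.transcriptLaw A B T) +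
                Omnipred.errorTerm C L k m T)) := by
  refine ⟨fun c K hc hK => ?_, 9, by norm_num, fun K hK => ?_⟩
  · exact Omnipred.lintegral_ownLoss_le_of_unbiasedOn hc hK
  · exact Omnipred.exists_learner_unbiasedOn_lintegral_ownLoss_le hK
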